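/- All graphs are finite, undirected and loopless, and parallel edges are allowed. An odd $k$-edge-coloring of a graph $G$ is a map $\varphi:E(G)\to\{1,\dots,k\}$ (not necessarily surjective, and parallel edges may receive the same color) such that for every vertex $v$ and every color $j$, the number of edges of color $j$ incident with $v$ is either zero or odd. The odd chromatic index $\chi'_{\mathrm{odd}}(G)$ is the least $k$ for which $G$ has an odd $k$-edge-coloring. A Shannon triangle of type $(2,2,2)$ is a graph on exactly three vertices, pairwise adjacent, in which each of the three pairs of vertices is joined by an even number of edges. A Shannon triangle of type $(2,2,1)$ is a graph on exactly three vertices, pairwise adjacent, in which two of the three pairs are joined by an even number of edges and the third pair by an odd number of edges. Theorem. Let $G$ be a connected graph that is not a Shannon triangle of type $(2,2,2)$ or $(2,2,1)$. Then either $\chi'_{\mathrm{odd}}(G)\le 3$, or $G$ has an odd $4$-edge-coloring in which one of the four colors is used on exactly one edge. In the latter case (that is, if $\chi'_{\mathrm{odd}}(G)>3$), for every odd $4$-edge-coloring of $G$ and every edge $e$ that is the only edge of its color, the graph $G\setminus\{e\}$ obtained by deleting $e$ satisfies $\chi'_{\mathrm{odd}}(G\setminus\{e\})=3$; in particular $G\setminus\{e\}$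 is odd $3$-edge-colorable. -/

import Mathlib

open scoped Graph

namespace OddEdge

/-- The set of edges of `G` joining `x` and `y`. -/
def linkSet {α β : Type*} (G : Graph α β) (x y : α) : Set β :=
  {e | G.IsLink e x y}

/-- A Shannon triangle of type `(2,2,2)`: three pairwise adjacent vertices, any two of them joined
by an even number of edges. -/
def IsShannon222 {α β : Type*} (G : Graph α β) : Prop :=
  ∃ x y z : α, x ≠ y ∧ x ≠ z ∧ y ≠ z ∧ G.vertexSet = {x, y, z} ∧
    G.Adj x y ∧ G.Adj x z ∧ G.Adj y z ∧
    Even (linkSet G x y).ncard ∧ Even (linkSet G x z).ncard ∧ Even (linkSet G y z).ncard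

/-- A Shannon triangle of type `(2,2,1)`: three pairwise adjacent vertices, two of the pairs joined
by an even number of edges and the third pair by an odd number of edges. -/
def IsShannon221 {α β : Type*} (G : Graph α β) : Prop :=
  ∃ x y z : α, x ≠ y ∧ x ≠ z ∧ y ≠ z ∧ G.vertexSet = {x, y, z} ∧
    G.Adj x y ∧ G.Adj x z ∧ G.Adj y z ∧
    Even (linkSet G x y).ncard ∧ Even (linkSet G x z).ncard ∧ Odd (linkSet G y z).ncard

/-- The edge set `F` forms an odd subgraph of the loopless graph `G`: every vertex incident with
an edge of `F` is incident with an odd number of edges of `F`. The empty set qualifies. -/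
def FormsOddGraph {α β : Type*} (G : Graph α β) (F : Set β) : Prop :=
  ∀ v : α, (∃ e ∈ F, G.Inc e v) → Odd {e ∈ F | G.Inc e v}.ncard

/-- The set of edges of `G` that receive the color `j`. -/
def colorClass {α β : Type*} {G : Graph α β} {k : ℕ} (φ : G.edgeSet → Fin k) (j : Fin k) :
    Set β :=
  {e | ∃ he : e ∈ G.edgeSet, φ ⟨e, he⟩ = j}

/-- `φ` is an odd `k`-edge-coloring of `G`: every color class forms an odd subgraph. Parallel edges
may share a color, and colors may be unused. -/
def IsOddEdgeColoring {α β : Type*} (G : Graph α β) {k : ℕ} (φ : G.edgeSet → Fin k) : Prop :=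
  ∀ j : Fin k, FormsOddGraph G (colorClass φ j)

/-- `G` is odd `k`-edge-colorable. -/
def OddEdgeColorable {α β : Type*} (G : Graph α β) (k : ℕ) : Prop :=
  ∃ φ : G.edgeSet → Fin k, IsOddEdgeColoring G φ

/-- The odd chromatic index: the least `k` such that `G` is odd `k`-edge-colorable
(`⊤` if there is no such `k`, which does not happen for finite loopless graphs). -/
noncomputable def oddChromaticIndex {α β : Type*} (G : Graph α β) : ℕ∞ :=
  ⨅ (k : ℕ) (_ : OddEdgeColorable G k), (k : ℕ∞)

end OddEdge

/-! The core claim is that a connected graph that is not a Shannon triangle becomes odd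
3-edge-colorable after deleting at most one edge (`Multigraph.nearlyColorable`). If one edge `e`
must go, giving it a fourth color yields the required coloring. Conversely, an odd 2-edge-coloring
of the graph without `e` would extend to an odd 3-edge-coloring of the whole graph.

Two tools drive everything. If every component has even order, a smallest T-join `F` exists whose
complement has odd degree everywhere, and `F` is a forest. A forest can be 2-colored from leaf to
leaf with a free choice of color at every vertex but one (`exists_coloring`), so it is odd
2-edge-colorable. This settles even order. In odd order, if some vertex `c` has a component of odd
order in its deletion, the graph is cut at `c` into two pieces of even order, which are colored with
the roles of the colors interchanged.

Otherwise a counterexample is critical: deleting any vertex `w` leaves only components of even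
order. Now color 0 goes to an odd spanning subgraph of the graph without `w`, and the remaining
forest together with the edges at `w` has to be 2-colored oddly. Only the vertex `w` is an obstacle,
and the three criteria `nearlyColorable_of_closed`, `nearlyColorable_of_even` and
`nearlyColorable_of_root` say when it can be overcome. Their failure for every admissible forest is
very restrictive: vertices of even degree have only even multiplicities, vertices of odd degree are
not cut vertices, and two adjacent vertices of even degree force a Shannon triangle. By the
handshake lemma some `w` has even degree. An extremal separation argument then finds a neighbor of
`w` with only two neighbors, which again forces a Shannon triangle. -/

/-- A loopless multigraph with vertex type `V` and edge type `B`; the order of the two ends of an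
edge is irrelevant. -/
structure Multigraph (V B : Type*) where
  fst : B → V
  snd : B → V
  ne : ∀ e, fst e ≠ snd e

namespace Multigraph

open Finset

/-! ### Degrees, closed vertex sets and T-joins. -/

section Basic

variable {V B : Type*} (M : Multigraph V B)

/-- The edge `e` joins `x` and `y`. -/
def Link (e : B) (x y : V) : Prop :=
  (M.fst e = x ∧ M.snd e = y) ∨ (M.fst e = y ∧ M.snd e = x)

/-- The vertex `x` is an end of the edge `e`. -/
def Inc (e : B) (x : V) : Prop := M.fst e = x ∨ M.snd e = x

instance [DecidableEq V] (e : B) (x : V) : Decidable (M.Inc e x) :=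
  inferInstanceAs (Decidable (_ ∨ _))

instance [DecidableEq V] (e : B) (x y : V) : Decidable (M.Link e x y) :=
  inferInstanceAs (Decidable (_ ∨ _))

/-- No edge of `S` leaves `X`. -/
def Closed (S : Finset B) (X : Finset V) : Prop := ∀ e ∈ S, (M.fst e ∈ X ↔ M.snd e ∈ X)

/-- The degree of `x` in the edge set `F`. -/
def dg [DecidableEq V] (F : Finset B) (x : V) : ℕ := (F.filter fun e => M.Inc e x).card

variable {M}

theorem Link.symm {e : B} {x y : V} (h : M.Link e x y) : M.Link e y x := by
  unfold Link at *; tauto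

theorem Link.ne {e : B} {x y : V} (h : M.Link e x y) : x ≠ y := by
  rintro rfl
  have := M.ne e
  rcases h with ⟨h1, h2⟩ | ⟨h1, h2⟩ <;> exact this (h1.trans h2.symm)

theorem Link.inc_iff {e : B} {x y : V} (h : M.Link e x y) (z : V) : M.Inc e z ↔ z = x ∨ z = y := by
  unfold Inc
  rcases h with ⟨rfl, rfl⟩ | ⟨rfl, rfl⟩ <;> constructor <;> rintro (h | h) <;> simp [h]

theorem Link.inc_left {e : B} {x y : V} (h : M.Link e x y) : M.Inc e x := by simp [h.inc_iff]

theorem Link.inc_right {e : B} {x y : V} (h : M.Link e x y) : M.Inc e y := by simp [h.inc_iff]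

theorem Inc.exists_link {e : B} {x : V} (h : M.Inc e x) : ∃ y, M.Link e x y := by
  rcases h with h | h
  · exact ⟨M.snd e, Or.inl ⟨h, rfl⟩⟩
  · exact ⟨M.fst e, Or.inr ⟨rfl, h⟩⟩

theorem link_of_inc {e : B} {x y : V} (hx : M.Inc e x) (hy : M.Inc e y) (h : x ≠ y) :
    M.Link e x y := by
  unfold Link Inc at *
  rcases hx with rfl | rfl <;> rcases hy with rfl | rfl <;> simp_all

variable (M) in
theorem link_fst_snd (e : B) : M.Link e (M.fst e) (M.snd e) := Or.inl ⟨rfl, rfl⟩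

theorem Closed.mem_iff {S : Finset B} {X : Finset V} (h : M.Closed S X) {e : B} (he : e ∈ S)
    {x y : V} (hl : M.Link e x y) : x ∈ X ↔ y ∈ X := by
  have := h e he
  rcases hl with ⟨rfl, rfl⟩ | ⟨rfl, rfl⟩ <;> tauto

theorem closed_of_link {S : Finset B} {X : Finset V}
    (h : ∀ e ∈ S, ∀ x y, M.Link e x y → x ∈ X → y ∈ X) : M.Closed S X := fun e he =>
  ⟨h e he _ _ (M.link_fst_snd e), h e he _ _ (M.link_fst_snd e).symm⟩

theorem Closed.mono {S S' : Finset B} {X : Finset V} (h : M.Closed S X) (hS : S' ⊆ S) :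
    M.Closed S' X := fun e he => h e (hS he)

variable [DecidableEq V]

theorem Closed.compl [Fintype V] {S : Finset B} {X : Finset V} (h : M.Closed S X) :
    M.Closed S Xᶜ := fun e he => by simpa using not_congr (h e he)

theorem dg_pos {F : Finset B} {x : V} : 0 < M.dg F x ↔ ∃ e ∈ F, M.Inc e x := by
  simp [dg, card_pos, Finset.Nonempty]

theorem dg_eq_zero {F : Finset B} {x : V} : M.dg F x = 0 ↔ ∀ e ∈ F, ¬ M.Inc e x := by
  simp [dg, filter_eq_empty_iff]

theorem dg_congr {F F' : Finset B} {x : V} (h : ∀ e, M.Inc e x → (e ∈ F ↔ e ∈ F')) :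
    M.dg F x = M.dg F' x := by
  unfold dg
  congr 1
  ext e
  simp only [mem_filter]
  exact ⟨fun ⟨a, b⟩ => ⟨(h e b).1 a, b⟩, fun ⟨a, b⟩ => ⟨(h e b).2 a, b⟩⟩

@[simp] theorem dg_empty (x : V) : M.dg ∅ x = 0 := by simp [dg]

theorem dg_filter_add (F : Finset B) (p : B → Prop) [DecidablePred p] (x : V) :
    M.dg (F.filter p) x + M.dg (F.filter fun e => ¬ p e) x = M.dg F x := by
  unfold dg
  rw [filter_comm, filter_comm (p := fun e => ¬ p e)]
  exact card_filter_add_card_filter_not _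

theorem dg_singleton (e : B) (x : V) : M.dg {e} x = if M.Inc e x then 1 else 0 := by
  unfold dg
  rw [filter_singleton]
  split_ifs <;> simp

theorem even_sum_dg {S F : Finset B} {X : Finset V} (h : M.Closed S X) (hF : F ⊆ S) :
    Even (∑ x ∈ X, M.dg F x) := by
  unfold dg
  simp_rw [card_filter]
  rw [sum_comm]
  refine Finset.even_sum _ fun e he => ?_
  rw [← card_filter]
  have h1 := h e (hF he)
  by_cases hf : M.fst e ∈ X
  · have : X.filter (fun x => M.Inc e x) = {M.fst e, M.snd e} := by
      ext z
      simp only [mem_filter, mem_insert, mem_singleton, (M.link_fst_snd e).inc_iff]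
      constructor
      · tauto
      · rintro (rfl | rfl) <;> tauto
    rw [this, card_pair (M.ne e)]
    decide
  · have : X.filter (fun x => M.Inc e x) = ∅ := by
      ext z
      simp only [mem_filter, (M.link_fst_snd e).inc_iff, notMem_empty, iff_false]
      rintro ⟨hz, rfl | rfl⟩ <;> tauto
    simp [this]

variable [DecidableEq B]

theorem dg_union {F F' : Finset B} (h : Disjoint F F') (x : V) :
    M.dg (F ∪ F') x = M.dg F x + M.dg F' x := by
  unfold dg
  rw [filter_union, card_union_of_disjoint]
  exact disjoint_filter_filter h

theorem dg_sdiff {F C : Finset B} (h : C ⊆ F) (x : V) :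
    M.dg (F \ C) x + M.dg C x = M.dg F x := by
  rw [← dg_union sdiff_disjoint, sdiff_union_of_subset h]

theorem dg_symmDiff (F C : Finset B) (x : V) :
    M.dg (symmDiff F C) x + 2 * M.dg (F ∩ C) x = M.dg F x + M.dg C x := by
  have h1 := M.dg_sdiff (inter_subset_left (s₁ := F) (s₂ := C)) x
  have h2 := M.dg_sdiff (inter_subset_right (s₁ := F) (s₂ := C)) x
  rw [sdiff_inter_self_left] at h1
  have e : C \ (F ∩ C) = C \ F := by ext; simp
  rw [e] at h2
  have h3 : M.dg (symmDiff F C) x = M.dg (F \ C) x + M.dg (C \ F) x := by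
    rw [← dg_union]
    · rfl
    · exact disjoint_sdiff_sdiff
  omega

theorem dg_insert {F : Finset B} {e : B} (h : e ∉ F) (x : V) :
    M.dg (insert e F) x = M.dg F x + if M.Inc e x then 1 else 0 := by
  rw [insert_eq, dg_union (by simpa using h), dg_singleton, add_comm]

theorem dg_erase {F : Finset B} {e : B} (h : e ∈ F) (x : V) :
    (M.dg (F.erase e) x + if M.Inc e x then 1 else 0) = M.dg F x := by
  rw [← dg_insert (notMem_erase e F), insert_erase h]

theorem sum_mod_two {ι : Type*} (s : Finset ι) {f g : ι → ℕ} (h : ∀ i ∈ s, f i % 2 = g i % 2) :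
    (∑ i ∈ s, f i) % 2 = (∑ i ∈ s, g i) % 2 := by
  rw [sum_nat_mod, sum_nat_mod s 2 g, sum_congr rfl h]

theorem exists_path {S : Finset B} {x y : V}
    (h : Relation.ReflTransGen (fun a b => ∃ e ∈ S, M.Link e a b) x y) :
    ∃ P ⊆ S, ∀ v, M.dg P v % 2 = ((if v = x then 1 else 0) + (if v = y then 1 else 0)) % 2 := by
  induction h with
  | refl => exact ⟨∅, by simp, fun v => by split_ifs <;> simp⟩
  | tail _ h ih =>
    obtain ⟨P, hP, hd⟩ := ih
    obtain ⟨e, he, hl⟩ := h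
    refine ⟨symmDiff P {e}, ?_, fun v => ?_⟩
    · intro a ha
      rw [mem_symmDiff, mem_singleton] at ha
      rcases ha with ha | ⟨rfl, -⟩
      · exact hP ha.1
      · exact he
    · have h1 := M.dg_symmDiff P {e} v
      have h2 := hd v
      rw [dg_singleton] at h1
      simp only [hl.inc_iff] at h1
      have := hl.ne
      split_ifs at * <;> first | omega | (subst_vars; simp_all)

/-- Take `F` with the fewest vertices of wrong parity. By the handshake lemma a component containing
one such vertex contains a second, and adding a path between them modulo 2 repairs both. -/
theorem exists_join [Fintype V] {S : Finset B} {τ : V → ℕ}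
    (h : ∀ X, M.Closed S X → Even (∑ v ∈ X, τ v)) : ∃ F ⊆ S, ∀ v, M.dg F v % 2 = τ v % 2 := by
  classical
  obtain ⟨F, hF, hmin⟩ := exists_min_image S.powerset
    (fun F => (univ.filter fun v => M.dg F v % 2 ≠ τ v % 2).card) ⟨∅, by simp⟩
  rw [mem_powerset] at hF
  refine ⟨F, hF, fun t => ?_⟩
  by_contra ht
  let X : Finset V := univ.filter
    fun y => Relation.ReflTransGen (fun a b => ∃ e ∈ S, M.Link e a b) t y
  have hX : M.Closed S X := closed_of_link fun e he x y hl hx => by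
    simp only [X, mem_filter, mem_univ, true_and] at hx ⊢
    exact hx.tail ⟨e, he, hl⟩
  have h1 := h X hX
  have h2 := even_sum_dg hX hF
  have htX : t ∈ X := by simp only [X, mem_filter, mem_univ, true_and]; exact .refl
  obtain ⟨y, hyX, hyt, hy⟩ : ∃ y ∈ X, y ≠ t ∧ M.dg F y % 2 ≠ τ y % 2 := by
    by_contra! hc
    rw [← add_sum_erase _ _ htX] at h1 h2
    have := sum_mod_two (X.erase t) fun i hi => hc i (mem_of_mem_erase hi) (ne_of_mem_erase hi)
    rw [Nat.even_iff] at h1 h2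
    omega
  simp only [X, mem_filter, mem_univ, true_and] at hyX
  obtain ⟨P, hP, hd⟩ := exists_path hyX
  have hS : symmDiff F P ⊆ S := by
    intro a ha
    rw [mem_symmDiff] at ha
    rcases ha with ha | ha
    · exact hF ha.1
    · exact hP ha.1
  have := hmin _ (mem_powerset.2 hS)
  refine absurd this (not_le.2 (card_lt_card ?_))
  rw [ssubset_iff_of_subset]
  · refine ⟨t, by simpa using ht, ?_⟩
    simp only [mem_filter, mem_univ, true_and, not_not]
    have h3 := M.dg_symmDiff F P t
    have h4 := hd t
    simp only [if_true, if_neg hyt.symm] at h4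
    omega
  · intro v
    simp only [mem_filter, mem_univ, true_and]
    have h3 := M.dg_symmDiff F P v
    have h4 := hd v
    split_ifs at h4 with h5 h6 h6
    · exact absurd (h6.symm.trans h5) hyt
    · subst h5; intro; exact ht
    · subst h6; intro; exact hy
    · omega

end Basic

/-! ### Forests: minimal joins, leaves, and gluing of local colorings. -/

section Forest

variable {V B : Type*} [DecidableEq V] {M : Multigraph V B}

variable (M) in
/-- The edge set `F` is acyclic: no nonempty subset has all degrees even. -/
def Acyclic (F : Finset B) : Prop := ∀ C ⊆ F, (∀ v, Even (M.dg C v)) → C = ∅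

theorem Acyclic.mono {F F' : Finset B} (h : M.Acyclic F) (hF : F' ⊆ F) : M.Acyclic F' :=
  fun C hC => h C (hC.trans hF)

variable [DecidableEq B]

theorem Acyclic.erase {F : Finset B} (h : M.Acyclic F) (e : B) : M.Acyclic (F.erase e) :=
  h.mono (erase_subset _ _)

/-- A join of minimum size is acyclic, and stays so when an edge is added that is not parallel to
one of its edges. -/
theorem exists_min_join [Fintype V] {S : Finset B} {τ : V → ℕ}
    (h : ∀ X, M.Closed S X → Even (∑ v ∈ X, τ v)) :
    ∃ F ⊆ S, (∀ v, M.dg F v % 2 = τ v % 2) ∧ M.Acyclic F ∧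
      ∀ e ∈ S, ∀ x y, M.Link e x y → (∀ f ∈ F, ¬ M.Link f x y) → M.Acyclic (insert e F) := by
  classical
  obtain ⟨F0, hF0, hd0⟩ := exists_join h
  obtain ⟨F, hF, hmin⟩ := exists_min_image
    (S.powerset.filter fun F => ∀ v, M.dg F v % 2 = τ v % 2) card
    ⟨F0, by simpa using ⟨hF0, hd0⟩⟩
  simp only [mem_filter, mem_powerset] at hF hmin
  obtain ⟨hF, hd⟩ := hF
  have hac : M.Acyclic F := fun C hC hev => by
    have := hmin (F \ C) ⟨sdiff_subset.trans hF, fun v => by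
      have := M.dg_sdiff hC v
      have := hd v
      have := Nat.even_iff.1 (hev v)
      omega⟩
    rw [card_sdiff_of_subset hC] at this
    have h2 := card_le_card hC
    exact card_eq_zero.1 (by omega)
  refine ⟨F, hF, hd, hac, fun e he x y hl hpar C hC hev => ?_⟩
  by_cases heC : e ∈ C
  swap
  · refine hac C (fun a ha => ?_) hev
    rcases mem_insert.1 (hC ha) with rfl | h
    · exact absurd ha heC
    · exact h
  exfalso
  have heF : e ∉ F := fun h => hpar e h hl
  have hCF : C.erase e ⊆ F := by
    intro a ha
    rw [mem_erase] at ha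
    exact (mem_insert.1 (hC ha.2)).resolve_left ha.1
  have hsub : symmDiff F C ⊆ S := by
    intro a ha
    rw [mem_symmDiff] at ha
    rcases ha with ha | ha
    · exact hF ha.1
    · rcases mem_insert.1 (hC ha.1) with rfl | h
      · exact he
      · exact hF h
  -- Adding the cycle `C` to `F` modulo 2 gives another join. It gains only `e` and loses the rest
  -- of `C`, so by minimality `C` has at most one edge besides `e`. That edge must be parallel to
  -- `e`.
  have h1 := hmin _ ⟨hsub, fun v => by
    have := M.dg_symmDiff F C v
    have := hd v
    have := Nat.even_iff.1 (hev v)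
    omega⟩
  have h2 : symmDiff F C = insert e (F \ C.erase e) := by
    ext a
    simp only [mem_symmDiff, mem_insert, mem_sdiff, mem_erase]
    by_cases hae : a = e
    · subst hae; simp [heC, heF]
    · simp only [hae, ne_eq, not_false_eq_true, true_and, false_or]
      constructor
      · rintro (h | h)
        · exact h
        · exact absurd (hCF (mem_erase.2 ⟨hae, h.1⟩)) h.2
      · exact Or.inl
  rw [h2, card_insert_of_notMem (by simp [heF]), card_sdiff_of_subset hCF] at h1
  have h3 := card_le_card hCF
  have h4 : (C.erase e).card ≤ 1 := by omega
  have key : ∀ z, M.Inc e z → ∃ f ∈ C.erase e, M.Inc f z := fun z hz => by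
    have := M.dg_erase heC z
    rw [if_pos hz] at this
    have := Nat.even_iff.1 (hev z)
    exact dg_pos.1 (by omega)
  obtain ⟨f, hf, hfx⟩ := key x hl.inc_left
  obtain ⟨g, hg, hgy⟩ := key y hl.inc_right
  rw [card_le_one.1 h4 g hg f hf] at hgy
  exact hpar f (hCF hf) (link_of_inc hfx hgy hl.ne)

/-- In an acyclic set a subset is determined by its vertices of odd degree, and by the handshake
lemma one vertex is redundant in this record. Counting subsets gives fewer edges than covered
vertices, so the covered degrees cannot all be at least 2. -/
theorem Acyclic.exists_leaf {Z : Finset B} (hZ : M.Acyclic Z) (hne : Z.Nonempty) :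
    ∃ v, M.dg Z v = 1 := by
  classical
  by_contra! hc
  let W : Finset V := Z.image M.fst ∪ Z.image M.snd
  have hW : ∀ e ∈ Z, ∀ v, M.Inc e v → v ∈ W := by
    intro e he v hv
    simp only [W, mem_union, mem_image]
    rcases hv with hv | hv
    · exact Or.inl ⟨e, he, hv⟩
    · exact Or.inr ⟨e, he, hv⟩
  obtain ⟨e0, he0⟩ := hne
  have hv0 : M.fst e0 ∈ W := hW e0 he0 _ (Or.inl rfl)
  have hcl : M.Closed Z W := fun e he =>
    iff_of_true (hW e he _ (Or.inl rfl)) (hW e he _ (Or.inr rfl))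
  have hcard : Z.powerset.card ≤ (W.erase (M.fst e0)).powerset.card := by
    refine card_le_card_of_injOn
      (fun C => (W.erase (M.fst e0)).filter fun v => M.dg C v % 2 = 1) ?_ ?_
    · intro C _
      exact mem_coe.2 (mem_powerset.2 (filter_subset _ _))
    · intro C hC C' hC' heq
      simp only [coe_powerset, Set.mem_preimage, Set.mem_powerset_iff, coe_subset] at hC hC'
      have h1 : ∀ v ∈ W.erase (M.fst e0), M.dg C v % 2 = M.dg C' v % 2 := fun v hv => by
        have := Finset.ext_iff.1 heq v
        simp only [mem_filter, hv, true_and] at this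
        omega
      have h2 : ∀ v, M.dg C v % 2 = M.dg C' v % 2 := fun v => by
        by_cases hvW : v ∈ W
        · by_cases hv : v = M.fst e0
          · have a := even_sum_dg hcl hC
            have b := even_sum_dg hcl hC'
            rw [← add_sum_erase _ _ hv0, Nat.even_iff] at a b
            have := sum_mod_two _ h1
            subst hv
            omega
          · exact h1 v (mem_erase.2 ⟨hv, hvW⟩)
        · rw [dg_eq_zero.2 fun e he h => hvW (hW e (hC he) v h),
            dg_eq_zero.2 fun e he h => hvW (hW e (hC' he) v h)]
      have h3 := hZ (symmDiff C C')
        (fun a ha => by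
          rw [mem_symmDiff] at ha
          rcases ha with ha | ha
          · exact hC ha.1
          · exact hC' ha.1)
        (fun v => by
          have := M.dg_symmDiff C C' v
          have := h2 v
          rw [Nat.even_iff]
          omega)
      exact symmDiff_eq_bot.1 h3
  rw [card_powerset, card_powerset, Nat.pow_le_pow_iff_right (by norm_num),
    card_erase_of_mem hv0] at hcard
  have hpos : 0 < W.card := card_pos.2 ⟨_, hv0⟩
  have h1 : ∑ v ∈ W, M.dg Z v = 2 * Z.card := by
    unfold dg
    simp_rw [card_filter]
    rw [sum_comm, card_eq_sum_ones, mul_sum]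
    refine sum_congr rfl fun e he => ?_
    rw [← card_filter]
    have : W.filter (fun x => M.Inc e x) = {M.fst e, M.snd e} := by
      ext z
      simp only [mem_filter, mem_insert, mem_singleton, (M.link_fst_snd e).inc_iff]
      refine ⟨fun h => h.2, fun h => ⟨hW e he z ?_, h⟩⟩
      exact ((M.link_fst_snd e).inc_iff z).2 h
    rw [this, card_pair (M.ne e), mul_one]
  have h2 : ∑ v ∈ W, 2 ≤ ∑ v ∈ W, M.dg Z v := by
    refine sum_le_sum fun v hv => ?_
    have : 0 < M.dg Z v := by
      simp only [W, mem_union, mem_image] at hv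
      rcases hv with ⟨e, he, h⟩ | ⟨e, he, h⟩
      · exact dg_pos.2 ⟨e, he, Or.inl h⟩
      · exact dg_pos.2 ⟨e, he, Or.inr h⟩
    have := hc v
    omega
  rw [sum_const, smul_eq_mul, h1] at h2
  omega

/-- Local constraints along a forest `Z` can be met simultaneously by a 2-coloring of the edges of
`H`, if at each vertex other than the root `r` the color of any single edge of `Z` can be
prescribed. The edges of `H` outside `Z` are each seen by at most one of the vertices of `U`. -/
theorem exists_coloring (n : ℕ) : ∀ (Z H : Finset B) (U : Finset V) (r : V)
    (P : V → (B → Bool) → Prop), Z.card = n → Z ⊆ H → M.Acyclic Z →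
    (∀ e ∈ Z, ∀ v, M.Inc e v → v ∈ U) →
    (∀ e ∈ H, e ∉ Z → ∀ x ∈ U, ∀ y ∈ U, M.Inc e x → M.Inc e y → x = y) →
    (∀ v ∈ U, ∀ χ χ' : B → Bool, (∀ e ∈ H, M.Inc e v → χ e = χ' e) → P v χ → P v χ') →
    (∀ v ∈ U, ∃ χ, P v χ) →
    (∀ v ∈ U, v ≠ r → ∀ f ∈ Z, M.Inc f v → ∀ c, ∃ χ, χ f = c ∧ P v χ) →
    ∃ χ, ∀ v ∈ U, P v χ := by
  classical
  induction n with
  | zero =>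
    intro Z H U r P hn hZH hac hZU hH hloc hex _
    obtain rfl := card_eq_zero.1 hn
    choose! X hX using hex
    -- With no forest edges left, each edge of `H` meets at most one vertex of `U`, and that vertex
    -- decides its color.
    refine ⟨fun e => if h : ∃ v ∈ U, M.Inc e v then X h.choose e else true, fun v hv => ?_⟩
    refine hloc v hv _ _ (fun e he hi => ?_) (hX v hv)
    have h : ∃ v ∈ U, M.Inc e v := ⟨v, hv, hi⟩
    have h2 := hH e he (notMem_empty _) _ hv _ h.choose_spec.1 hi h.choose_spec.2
    rw [dif_pos h, ← h2]
  | succ n ih =>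
    intro Z H U r P hn hZH hac hZU hH hloc hex hext
    obtain ⟨l, hl⟩ := hac.exists_leaf (card_pos.1 (by omega))
    obtain ⟨f, hf⟩ := card_eq_one.1 hl
    have hfm : f ∈ Z ∧ M.Inc f l := by simpa using (Finset.ext_iff.1 hf f).2 (by simp)
    have huniq : ∀ g ∈ Z, M.Inc g l → g = f := fun g hg hi => by
      simpa using (Finset.ext_iff.1 hf g).1 (by simp [hg, hi])
    obtain ⟨hfZ, hfl⟩ := hfm
    obtain ⟨p, hp⟩ := hfl.exists_link
    have hlU := hZU f hfZ l hfl
    have hpU := hZU f hfZ p hp.inc_right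
    have hlp := hp.ne
    -- The leaf `l` is removed with all its edges. Its constraint is absorbed by its neighbor `p`:
    -- the color of `f` must come from some coloring that suits `l`.
    let P' : V → (B → Bool) → Prop := fun v χ =>
      if v = p then ∃ χ', P l χ' ∧ P p (Function.update χ f (χ' f)) else P v χ
    have hP'p : ∀ χ, P' p χ ↔ ∃ χ', P l χ' ∧ P p (Function.update χ f (χ' f)) := fun χ => by
      simp [P']
    have hP'v : ∀ v ≠ p, ∀ χ, P' v χ ↔ P v χ := fun v hv χ => by simp [P', hv]
    have hnot : ∀ e ∈ H, e ≠ f → ∀ v ∈ U, v ≠ l → M.Inc e v → ¬ M.Inc e l := by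
      intro e he hef v hv hvl hev hel
      by_cases heZ : e ∈ Z
      · exact hef (huniq e heZ hel)
      · exact hvl (hH e he heZ v hv l hlU hev hel)
    -- If the leaf is the root, it cannot adapt to a prescribed color of `f`. Then `p` spends its
    -- own freedom on `f` and becomes the new root.
    obtain ⟨χ, hχ⟩ := ih (Z.erase f) (H.filter fun e => ¬ M.Inc e l) (U.erase l)
      (if l = r then p else r) P' (by rw [card_erase_of_mem hfZ]; omega)
      (fun e he => by
        rw [mem_erase] at he
        exact mem_filter.2 ⟨hZH he.2, fun h => he.1 (huniq e he.2 h)⟩)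
      (hac.erase f)
      (fun e he v hv => by
        rw [mem_erase] at he
        refine mem_erase.2 ⟨?_, hZU e he.2 v hv⟩
        rintro rfl
        exact he.1 (huniq e he.2 hv))
      (fun e he heZ x hx y hy hex hey => by
        rw [mem_filter] at he
        refine hH e he.1 (fun h => heZ (mem_erase.2 ⟨?_, h⟩)) x (mem_of_mem_erase hx) y
          (mem_of_mem_erase hy) hex hey
        rintro rfl
        exact he.2 hfl)
      (fun v hv χ χ' hag hPv => by
        rw [mem_erase] at hv
        by_cases hvp : v = p
        · subst hvp
          rw [hP'p] at hPv ⊢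
          obtain ⟨χ0, h0, h1⟩ := hPv
          refine ⟨χ0, h0, hloc _ hv.2 _ _ (fun e he hi => ?_) h1⟩
          by_cases hef : e = f
          · subst hef; simp
          · simp only [Function.update_of_ne hef]
            exact hag e (mem_filter.2 ⟨he, hnot e he hef v hv.2 hv.1 hi⟩) hi
        · rw [hP'v v hvp] at hPv ⊢
          refine hloc v hv.2 _ _ (fun e he hi => hag e (mem_filter.2 ⟨he, ?_⟩) hi) hPv
          refine hnot e he ?_ v hv.2 hv.1 hi
          rintro rfl
          rcases (hp.inc_iff v).1 hi with h | h
          · exact hv.1 h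
          · exact hvp h)
      (fun v hv => by
        rw [mem_erase] at hv
        by_cases hvp : v = p
        · subst hvp
          simp only [hP'p]
          by_cases hlr : l = r
          · obtain ⟨χ', h'⟩ := hex l hlU
            obtain ⟨χ, h1, h2⟩ := hext v hpU (fun h => hlp (hlr.trans h.symm)) f hfZ hp.inc_right
              (χ' f)
            refine ⟨χ, χ', h', ?_⟩
            rwa [← h1, Function.update_eq_self]
          · obtain ⟨χ, h⟩ := hex v hpU
            obtain ⟨χ', h1, h2⟩ := hext l hlU hlr f hfZ hfl (χ f)
            refine ⟨χ, χ', h2, ?_⟩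
            rwa [h1, Function.update_eq_self]
        · simp only [hP'v v hvp]
          exact hex v hv.2)
      (fun v hv hvr g hg hgv c => by
        rw [mem_erase] at hv hg
        by_cases hvp : v = p
        · subst hvp
          have hlr : l ≠ r := fun h => by simp [h] at hvr
          rw [if_neg hlr] at hvr
          obtain ⟨χ, h1, h2⟩ := hext v hpU hvr g hg.2 hgv c
          obtain ⟨χ', h3, h4⟩ := hext l hlU hlr f hfZ hfl (χ f)
          refine ⟨χ, h1, (hP'p _).2 ⟨χ', h4, ?_⟩⟩
          rwa [h3, Function.update_eq_self]
        · have hvr' : v ≠ r := by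
            split_ifs at hvr with h
            · rw [← h]; exact hv.1
            · exact hvr
          obtain ⟨χ, h1, h2⟩ := hext v hv.2 hvr' g hg.2 hgv c
          exact ⟨χ, h1, (hP'v v hvp _).2 h2⟩)
    obtain ⟨χ', hl', hp'⟩ := (hP'p χ).1 (hχ p (mem_erase.2 ⟨hlp.symm, hpU⟩))
    refine ⟨fun e => if M.Inc e l then χ' e else χ e, fun v hv => ?_⟩
    by_cases hvl : v = l
    · subst hvl
      exact hloc v hv _ _ (fun e _ hi => by simp [hi]) hl'
    · by_cases hvp : v = p
      · subst hvp
        refine hloc v hv _ _ (fun e he hi => ?_) hp'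
        by_cases hef : e = f
        · subst hef; simp [hfl]
        · simp [Function.update_of_ne hef, hnot e he hef v hv hvl hi]
      · refine hloc v hv _ _ (fun e he hi => ?_)
          ((hP'v v hvp χ).1 (hχ v (mem_erase.2 ⟨hvl, hv⟩)))
        have : ¬ M.Inc e l := hnot e he (by
          rintro rfl
          rcases (hp.inc_iff v).1 hi with h | h
          · exact hvl h
          · exact hvp h) v hv hvl hi
        simp [this]

end Forest

/-! ### Odd 2-colorings of a forest together with the edges at one vertex. -/

section Coloring

variable {V B : Type*} [DecidableEq V] {M : Multigraph V B}

variable (M) in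
/-- Every vertex that is incident with an edge of `F` has odd degree in `F`. -/
def OddSet (F : Finset B) : Prop := ∀ v, M.dg F v = 0 ∨ Odd (M.dg F v)

variable (M) in
/-- After deleting at most one edge, `M` has an odd 3-edge-coloring. -/
def NearlyColorable [Fintype B] [DecidableEq B] : Prop :=
  ∃ (D : Finset B) (φ : B → Fin 3), D.card ≤ 1 ∧
    ∀ j, M.OddSet (univ.filter fun e => e ∉ D ∧ φ e = j)

variable (M) in
/-- The number of edges of `H` at `x` of color `c`. -/
def cdg (H : Finset B) (χ : B → Bool) (c : Bool) (x : V) : ℕ :=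
  M.dg (H.filter fun e => χ e = c) x

variable (M) in
/-- The 2-coloring `χ` of `H` is odd at `x`. -/
def OddAt (H : Finset B) (x : V) (χ : B → Bool) : Prop :=
  ∀ c, M.cdg H χ c x = 0 ∨ Odd (M.cdg H χ c x)

theorem cdg_add_cdg_not (H : Finset B) (χ : B → Bool) (c : Bool) (x : V) :
    M.cdg H χ c x + M.cdg H χ (!c) x = M.dg H x := by
  rw [← M.dg_filter_add H (fun e => χ e = c) x]
  unfold cdg
  congr 2
  ext e
  simp only [mem_filter]
  cases χ e <;> cases c <;> simp

theorem cdg_congr {H : Finset B} {χ χ' : B → Bool} {x : V}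
    (h : ∀ e ∈ H, M.Inc e x → χ e = χ' e) (c : Bool) : M.cdg H χ c x = M.cdg H χ' c x := by
  refine dg_congr fun e he => ?_
  simp only [mem_filter]
  exact ⟨fun ⟨a, b⟩ => ⟨a, h e a he ▸ b⟩, fun ⟨a, b⟩ => ⟨a, (h e a he).trans b⟩⟩

theorem OddAt.congr {H : Finset B} {χ χ' : B → Bool} {x : V} (hχ : M.OddAt H x χ)
    (h : ∀ e ∈ H, M.Inc e x → χ e = χ' e) : M.OddAt H x χ' := fun c => by
  rw [← cdg_congr h]; exact hχ c

theorem oddAt_of_cdg {H : Finset B} {χ : B → Bool} {x : V} (c : Bool)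
    (h : M.cdg H χ c x = 0 ∨ Odd (M.cdg H χ c x))
    (h' : M.cdg H χ (!c) x = 0 ∨ Odd (M.cdg H χ (!c) x)) : M.OddAt H x χ := by
  intro d
  cases c <;> cases d <;> assumption

theorem cdg_const (H : Finset B) (c : Bool) (x : V) : M.cdg H (fun _ => c) c x = M.dg H x := by
  simp [cdg]

theorem oddAt_const {H : Finset B} {x : V} (h : Odd (M.dg H x)) (c : Bool) :
    M.OddAt H x fun _ => c := by
  have h1 := M.cdg_add_cdg_not H (fun _ => c) c x
  have h2 := M.cdg_const H c x
  refine oddAt_of_cdg c (Or.inr (h2 ▸ h)) (Or.inl (by omega))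

variable (M) in
/-- The edges that are not incident with `w`. -/
def off [Fintype B] (w : V) : Finset B := univ.filter fun e => ¬ M.Inc e w

theorem mem_off [Fintype B] {w : V} {e : B} : e ∈ M.off w ↔ ¬ M.Inc e w := by simp [off]

variable [DecidableEq B]

theorem cdg_single {H : Finset B} {g : B} {x : V} (hg : g ∈ H) (hgx : M.Inc g x) (c : Bool) :
    M.cdg H (fun e => if e = g then c else !c) c x = 1 := by
  have : (H.filter fun e => (if e = g then c else !c) = c) = {g} := by
    ext e
    simp only [mem_filter, mem_singleton]
    constructor
    · rintro ⟨-, h⟩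
      by_contra hne
      simp [hne] at h
    · rintro rfl
      simp [hg]
  rw [cdg, this, dg_singleton, if_pos hgx]

theorem oddAt_single {H : Finset B} {x : V} (h : Even (M.dg H x)) {g : B} (hg : g ∈ H)
    (hgx : M.Inc g x) (c : Bool) : M.OddAt H x fun e => if e = g then c else !c := by
  have h1 := M.cdg_add_cdg_not H (fun e => if e = g then c else !c) c x
  have h2 := cdg_single hg hgx c
  rw [Nat.even_iff] at h
  refine oddAt_of_cdg c (Or.inr (by rw [h2]; decide)) (Or.inr ?_)
  rw [Nat.odd_iff]
  omega

/-- At odd degree all edges take the color `c`; at even degree `f` alone takes it. This is the local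
freedom that `exists_coloring` needs at vertices other than the root. -/
theorem exists_oddAt {H : Finset B} {x : V} {f : B} (hf : f ∈ H) (hfx : M.Inc f x) (c : Bool) :
    ∃ χ, χ f = c ∧ M.OddAt H x χ := by
  rcases Nat.even_or_odd (M.dg H x) with h | h
  · exact ⟨_, by simp, oddAt_single h hf hfx c⟩
  · exact ⟨_, rfl, oddAt_const h c⟩

theorem exists_oddAt' (H : Finset B) (x : V) : ∃ χ, M.OddAt H x χ := by
  rcases Nat.eq_zero_or_pos (M.dg H x) with h | h
  · refine ⟨fun _ => true, fun c => Or.inl ?_⟩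
    rw [dg_eq_zero] at h
    exact dg_eq_zero.2 fun e he => h e (mem_filter.1 he).1
  · obtain ⟨f, hf, hfx⟩ := dg_pos.1 h
    obtain ⟨χ, -, h⟩ := exists_oddAt hf hfx true
    exact ⟨χ, h⟩

variable [Fintype B]

theorem nearlyColorable_of_oddAt {D H : Finset B} {χ : B → Bool} (hD : D.card ≤ 1)
    (hDH : Disjoint D H) (hA : M.OddSet (univ \ (H ∪ D))) (hH : ∀ x, M.OddAt H x χ) :
    M.NearlyColorable := by
  refine ⟨D, fun e => if e ∈ H then (if χ e then 1 else 2) else 0, hD, fun j => ?_⟩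
  rw [disjoint_right] at hDH
  have key : ∀ c : Bool, ∀ j : Fin 3, j = (if c then 1 else 2) →
      M.OddSet (univ.filter fun e => e ∉ D ∧ (if e ∈ H then (if χ e then 1 else 2) else 0) = j) := by
    rintro c j rfl x
    convert hH x c using 2 <;>
    · refine dg_congr fun e _ => ?_
      have := @hDH e
      simp only [mem_filter, mem_univ, true_and]
      by_cases he : e ∈ H
      · cases hc : χ e <;> cases c <;> simp_all
      · cases c <;> simp_all
  fin_cases j
  · convert hA using 1
    ext e
    simp only [mem_filter, mem_univ, true_and, mem_sdiff, mem_union]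
    by_cases he : e ∈ H
    · cases hc : χ e <;> simp_all
    · simp_all
  · exact key true 1 rfl
  · exact key false 2 rfl

variable (M)

/-- The edges outside `D` that are incident with `w`. -/
def star (w : V) (D : Finset B) : Finset B := univ.filter fun e => M.Inc e w ∧ e ∉ D

/-- Deleting `H` and `D` from `M - w` leaves a graph with all degrees odd, where `H` is a forest
and `D` has at most one edge. -/
structure IsSplit (w : V) (D H : Finset B) : Prop where
  card_le : D.card ≤ 1
  disj : Disjoint D H
  subset : H ⊆ M.off w
  acyclic : M.Acyclic H
  odd : ∀ x ≠ w, Odd (M.dg (M.off w \ (H ∪ D)) x)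

variable {M}

theorem mem_star {w : V} {D : Finset B} {e : B} : e ∈ M.star w D ↔ M.Inc e w ∧ e ∉ D := by
  simp [star]

namespace IsSplit

variable {w : V} {D H : Finset B}

theorem not_inc (hs : M.IsSplit w D H) {e : B} (he : e ∈ H) : ¬ M.Inc e w :=
  mem_off.1 (hs.subset he)

theorem disjoint_star (hs : M.IsSplit w D H) : Disjoint H (M.star w D) :=
  disjoint_left.2 fun _ he h => hs.not_inc he (mem_star.1 h).1

theorem dg_union_star (hs : M.IsSplit w D H) (x : V) :
    M.dg (H ∪ M.star w D) x = M.dg H x + M.dg (M.star w D) x :=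
  dg_union hs.disjoint_star x

theorem dg_self (hs : M.IsSplit w D H) : M.dg H w = 0 := dg_eq_zero.2 fun _ he => hs.not_inc he

theorem nearlyColorable (hs : M.IsSplit w D H) {χ : B → Bool}
    (hχ : ∀ x, M.OddAt (H ∪ M.star w D) x χ) : M.NearlyColorable := by
  refine nearlyColorable_of_oddAt hs.card_le ?_ (fun x => ?_) hχ
  · exact disjoint_union_right.2 ⟨hs.disj, disjoint_right.2 fun e he => (mem_star.1 he).2⟩
  · have : univ \ (H ∪ M.star w D ∪ D) = M.off w \ (H ∪ D) := by
      ext e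
      simp only [mem_sdiff, mem_univ, mem_union, mem_star, mem_off, true_and]
      tauto
    rw [this]
    by_cases hx : x = w
    · subst hx
      exact Or.inl (dg_eq_zero.2 fun e he => mem_off.1 (mem_sdiff.1 he).1)
    · exact Or.inr (hs.odd x hx)

theorem exists_coloring [Fintype V] (hs : M.IsSplit w D H) (r : V) (P : V → (B → Bool) → Prop)
    (hloc : ∀ v ≠ w, ∀ χ χ' : B → Bool,
      (∀ e ∈ H ∪ M.star w D, M.Inc e v → χ e = χ' e) → P v χ → P v χ')
    (hex : ∀ v ≠ w, ∃ χ, P v χ)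
    (hext : ∀ v ≠ w, v ≠ r → ∀ f ∈ H, M.Inc f v → ∀ c, ∃ χ, χ f = c ∧ P v χ) :
    ∃ χ, ∀ v ≠ w, P v χ := by
  obtain ⟨χ, h⟩ := Multigraph.exists_coloring _ H (H ∪ M.star w D) (univ.erase w) r P rfl
    subset_union_left hs.acyclic
    (fun e he v hv => mem_erase.2 ⟨by rintro rfl; exact hs.not_inc he hv, mem_univ _⟩)
    (fun e he heH x hx y hy hex hey => by
      have hw := (mem_star.1 ((mem_union.1 he).resolve_left heH)).1
      by_contra hxy
      rcases ((link_of_inc hex hey hxy).inc_iff w).1 hw with h | h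
      · exact ne_of_mem_erase hx h.symm
      · exact ne_of_mem_erase hy h.symm)
    (fun v hv => hloc v (ne_of_mem_erase hv)) (fun v hv => hex v (ne_of_mem_erase hv))
    (fun v hv => hext v (ne_of_mem_erase hv))
  exact ⟨χ, fun v hv => h v (mem_erase.2 ⟨hv, mem_univ _⟩)⟩

theorem oddAt_self (hs : M.IsSplit w D H) (hev : Even (M.dg (M.star w D) w)) {χ : B → Bool}
    (h : Odd (M.cdg (M.star w D) χ true w)) : M.OddAt (H ∪ M.star w D) w χ := by
  have key : ∀ c, M.cdg (H ∪ M.star w D) χ c w = M.cdg (M.star w D) χ c w := fun c => by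
    refine dg_congr fun e he => ?_
    simp only [mem_filter, mem_union]
    have := fun h => hs.not_inc (e := e) h
    tauto
  have h1 := M.cdg_add_cdg_not (M.star w D) χ true w
  refine oddAt_of_cdg true (Or.inr (key _ ▸ h)) (Or.inr (key _ ▸ ?_))
  rw [Nat.even_iff] at hev
  rw [Nat.odd_iff] at h ⊢
  omega

/-- Color oddly away from `w`. The degree at `w` is even, so only the case of two even color counts
at `w` is bad. Exchanging the two colors on all edges that meet `K` keeps oddness elsewhere and, as
oddly many edges join `w` to `K`, changes the parity at `w`. -/
theorem nearlyColorable_of_closed [Fintype V] (hs : M.IsSplit w D H)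
    (hev : Even (M.dg (M.star w D) w)) {K : Finset V} (hK : M.Closed H K) (hwK : w ∉ K)
    (hodd : Odd (∑ x ∈ K, M.dg (M.star w D) x)) : M.NearlyColorable := by
  obtain ⟨χ, hχ⟩ := hs.exists_coloring w (fun x χ => M.OddAt (H ∪ M.star w D) x χ)
    (fun v _ χ χ' hag h => h.congr hag) (fun v _ => exists_oddAt' _ v)
    (fun v _ _ f hf hfv c => exists_oddAt (mem_union_left _ hf) hfv c)
  have all : ∀ χ : B → Bool, (∀ x ≠ w, M.OddAt (H ∪ M.star w D) x χ) →
      Odd (M.cdg (M.star w D) χ true w) → M.NearlyColorable := fun χ h1 h2 =>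
    hs.nearlyColorable fun x => by
      by_cases hx : x = w
      · rw [hx]; exact hs.oddAt_self hev h2
      · exact h1 x hx
  rcases Nat.even_or_odd (M.cdg (M.star w D) χ true w) with he | ho
  swap
  · exact all χ hχ ho
  let p : B → Prop := fun e => M.fst e ∈ K ∨ M.snd e ∈ K
  have hp : ∀ e x, M.Inc e x → x ∈ K → p e := by
    rintro e x (rfl | rfl) hx
    · exact Or.inl hx
    · exact Or.inr hx
  let χ' : B → Bool := fun e => if p e then !χ e else χ e
  refine all χ' (fun x hxw => ?_) ?_
  · by_cases hx : x ∈ K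
    · intro c
      have : M.cdg (H ∪ M.star w D) χ' c x = M.cdg (H ∪ M.star w D) χ (!c) x := by
        refine dg_congr fun e he => ?_
        simp only [mem_filter, χ', if_pos (hp e x he hx)]
        cases χ e <;> cases c <;> simp
      rw [this]
      exact hχ x hxw _
    · refine (hχ x hxw).congr fun e he hi => ?_
      have : ¬ p e := by
        obtain ⟨y, hl⟩ := hi.exists_link
        have hy : y ∉ K := by
          rcases mem_union.1 he with h | h
          · rwa [← hK.mem_iff h hl]
          · rcases (hl.inc_iff w).1 (mem_star.1 h).1 with h | h
            · exact absurd h.symm hxw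
            · rwa [← h]
        rcases hl with ⟨h1, h2⟩ | ⟨h1, h2⟩ <;> simp only [p, h1, h2] <;> tauto
      simp [χ', this]
  · set S := M.star w D
    have h1 : Even (∑ x ∈ insert w K, M.dg (S.filter p) x) := by
      refine even_sum_dg (S := S.filter p) (fun e he => ?_) Subset.rfl
      simp only [mem_filter, S, mem_star, p] at he
      have := M.ne e
      rcases he.1.1 with h | h
      · simp only [h] at this he ⊢
        simp only [mem_insert, true_or, true_iff]
        exact Or.inr (he.2.resolve_left hwK)
      · simp only [h] at this he ⊢
        simp only [mem_insert, true_or, iff_true]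
        exact Or.inr (he.2.resolve_right hwK)
    rw [sum_insert hwK] at h1
    have h2 : ∑ x ∈ K, M.dg (S.filter p) x = ∑ x ∈ K, M.dg S x :=
      sum_congr rfl fun x hx => dg_congr fun e he => by simp [hp e x he hx]
    have a1 := M.dg_filter_add (S.filter fun e => χ e = true) p w
    have a2 := M.dg_filter_add (S.filter fun e => χ' e = true) p w
    have a3 := M.cdg_add_cdg_not (S.filter p) χ true w
    have b1 : ((S.filter fun e => χ' e = true).filter fun e => ¬ p e) =
        (S.filter fun e => χ e = true).filter fun e => ¬ p e := by
      ext e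
      simp only [mem_filter, χ']
      by_cases hpe : p e <;> simp [hpe]
    have b2 : ((S.filter fun e => χ' e = true).filter p) =
        ((S.filter p).filter fun e => χ e = !true) := by
      ext e
      simp only [mem_filter, χ']
      by_cases hpe : p e <;> simp [hpe]
    have b3 : ((S.filter fun e => χ e = true).filter p) =
        ((S.filter p).filter fun e => χ e = true) := filter_comm _ _ _
    rw [b3] at a1
    rw [b1, b2] at a2
    rw [h2] at h1
    unfold cdg at he a3 ⊢
    rw [Nat.even_iff] at he h1
    rw [Nat.odd_iff] at hodd ⊢
    omega

/-- The number of edges of color `true` between `w` and a neighbor `x` can be prescribed modulo 2 as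
follows: even if `x` has odd degree in `H` (all edges at `x` alike), odd if `x` is isolated in `H`,
and arbitrary if the degree is even and positive. Either alternative in `h` lets these parities sum
to an odd number, so both colors are odd at `w`. -/
theorem nearlyColorable_of_even [Fintype V] (hs : M.IsSplit w D H)
    (hev : ∀ x ≠ w, Even (M.dg (M.star w D) x))
    (h : (∃ x ≠ w, 0 < M.dg (M.star w D) x ∧ 0 < M.dg H x ∧ Even (M.dg H x)) ∨
      Odd (univ.filter fun x => x ≠ w ∧ 0 < M.dg (M.star w D) x ∧ M.dg H x = 0).card) :
    M.NearlyColorable := by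
  have hsum : ∀ F : Finset B, (M.dg F w + ∑ x ∈ univ.erase w, M.dg F x) % 2 = 0 := fun F => by
    rw [add_sum_erase _ _ (mem_univ w)]
    exact Nat.even_iff.1 (even_sum_dg (S := F) (by simp [Closed]) Subset.rfl)
  set S := M.star w D with hS
  -- `β` records the prescribed parities. If the forced ones sum to an even number, a neighbor with
  -- a free choice contributes one more.
  obtain ⟨β, hβsum, hβ⟩ : ∃ β : V → ℕ, Odd (∑ x ∈ univ.erase w, β x) ∧ ∀ x ≠ w,
      (Odd (M.dg H x) → β x = 0) ∧ (M.dg H x = 0 → β x = if 0 < M.dg S x then 1 else 0) ∧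
      (β x = 0 ∨ β x = 1 ∧ 0 < M.dg S x) := by
    let β0 : V → ℕ := fun x => if 0 < M.dg S x ∧ M.dg H x = 0 then 1 else 0
    have hβ0 : ∑ x ∈ univ.erase w, β0 x =
        (univ.filter fun x => x ≠ w ∧ 0 < M.dg S x ∧ M.dg H x = 0).card := by
      rw [sum_boole, Nat.cast_id]
      congr 1
      ext x
      simp
    rcases Nat.even_or_odd (∑ x ∈ univ.erase w, β0 x) with he | ho
    · obtain ⟨y, hyw, hyS, hyH, hyev⟩ := h.resolve_right
        (by rw [← hβ0]; exact Nat.not_odd_iff_even.2 he)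
      refine ⟨fun x => β0 x + if x = y then 1 else 0, ?_, fun x hx => ?_⟩
      · rw [sum_add_distrib, sum_ite_eq', if_pos (mem_erase.2 ⟨hyw, mem_univ _⟩)]
        exact he.add_one
      · simp only [β0]
        by_cases hxy : x = y
        · subst hxy
          refine ⟨fun h => absurd hyev (Nat.not_even_iff_odd.2 h), fun h => by omega, ?_⟩
          right
          simp [hyS, hyH.ne']
        · simp only [hxy, if_false, add_zero]
          refine ⟨fun h => if_neg fun h' => by simp [h'.2] at h, fun h => by simp [h], ?_⟩
          split_ifs with h
          · exact Or.inr ⟨rfl, h.1⟩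
          · exact Or.inl rfl
    · refine ⟨β0, ho, fun x hx => ?_⟩
      refine ⟨fun h => if_neg fun h' => by simp [h'.2] at h, fun h => by simp [β0, h], ?_⟩
      simp only [β0]
      split_ifs with h
      · exact Or.inr ⟨rfl, h.1⟩
      · exact Or.inl rfl
  have hpend : ∀ x ≠ w, ∀ g ∈ S, M.Inc g x → ∀ c,
      M.cdg S (fun e => if e = g then c else !c) true x % 2 = 1 := fun x hx g hg hgx c => by
    have h1 := cdg_single hg hgx c
    have h2 := M.cdg_add_cdg_not S (fun e => if e = g then c else !c) c x
    have h3 := Nat.even_iff.1 (hev x hx)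
    cases c
    · simp_all
      omega
    · simp_all
  have hpend' : ∀ x ≠ w, ∀ g ∉ S, ∀ c,
      M.cdg S (fun e => if e = g then c else !c) true x % 2 = 0 := fun x hx g hg c => by
    have h1 : M.cdg S (fun e => if e = g then c else !c) true x = M.cdg S (fun _ => !c) true x :=
      cdg_congr (fun e he _ => if_neg (by rintro rfl; exact hg he)) _
    have h3 := Nat.even_iff.1 (hev x hx)
    rw [h1]
    have h4 := M.cdg_const S (!c) x
    have h5 := M.cdg_add_cdg_not S (fun _ => !c) (!c) x
    cases c <;> simp_all
  have hconst : ∀ x ≠ w, ∀ c, M.cdg S (fun _ => c) true x % 2 = 0 := fun x hx c => by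
    have h3 := Nat.even_iff.1 (hev x hx)
    have h4 := M.cdg_const S c x
    have h5 := M.cdg_add_cdg_not S (fun _ => c) c x
    cases c <;> simp_all
  have hdg : ∀ x, M.dg (H ∪ S) x = M.dg H x + M.dg S x := hs.dg_union_star
  have hext : ∀ v ≠ w, ∀ f ∈ H, M.Inc f v → ∀ c, ∃ χ : B → Bool, χ f = c ∧
      M.OddAt (H ∪ S) v χ ∧ M.cdg S χ true v % 2 = β v % 2 := by
    intro v hv f hf hfv c
    obtain ⟨h1, h2, h3⟩ := hβ v hv
    have hd := hdg v
    have hfS : f ∉ S := disjoint_left.1 hs.disjoint_star hf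
    have hev' := hev v hv
    rcases Nat.even_or_odd (M.dg H v) with he | ho
    · have he2 : Even (M.dg (H ∪ S) v) := hd ▸ he.add hev'
      rcases h3 with h3 | ⟨h3, h4⟩
      · exact ⟨_, by simp, oddAt_single he2 (mem_union_left _ hf) hfv c,
          by rw [hpend' v hv f hfS, h3]⟩
      · obtain ⟨g, hg, hgv⟩ := dg_pos.1 h4
        have hfg : f ≠ g := by rintro rfl; exact hfS hg
        exact ⟨fun e => if e = g then !c else !!c, by simp [hfg],
          oddAt_single he2 (mem_union_right _ hg) hgv (!c), by rw [hpend v hv g hg hgv, h3]⟩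
    · have ho2 : Odd (M.dg (H ∪ S) v) := hd ▸ ho.add_even hev'
      exact ⟨_, rfl, oddAt_const ho2 c, by rw [hconst v hv, h1 ho]⟩
  obtain ⟨χ, hχ⟩ := hs.exists_coloring w
    (fun x χ => M.OddAt (H ∪ S) x χ ∧ M.cdg S χ true x % 2 = β x % 2)
    (fun v _ χ χ' hag h => ⟨h.1.congr hag, by
      rw [← h.2, cdg_congr fun e he hi => (hag e (mem_union_right _ he) hi).symm]⟩)
    (fun v hv => by
      rcases Nat.eq_zero_or_pos (M.dg H v) with h0 | h0
      · have h2 := (hβ v hv).2.1 h0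
        split_ifs at h2 with hS0
        · obtain ⟨g, hg, hgv⟩ := dg_pos.1 hS0
          refine ⟨_, oddAt_single ?_ (mem_union_right _ hg) hgv true,
            by rw [hpend v hv g hg hgv, h2]⟩
          rw [hdg, h0, zero_add]
          exact hev v hv
        · refine ⟨fun _ => true, fun c => Or.inl ?_, by rw [hconst v hv, h2]⟩
          have h5 := M.cdg_add_cdg_not (H ∪ S) (fun _ => true) c v
          rw [hdg] at h5
          omega
      · obtain ⟨f, hf, hfv⟩ := dg_pos.1 h0
        obtain ⟨χ, -, h⟩ := hext v hv f hf hfv true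
        exact ⟨χ, h⟩)
    (fun v hv _ f hf hfv c => hext v hv f hf hfv c)
  refine hs.nearlyColorable (χ := χ) fun x => ?_
  by_cases hx : x = w
  · rw [hx]
    refine hs.oddAt_self ?_ ?_
    · change Even (M.dg S w)
      have h1 := hsum S
      have h2 : Even (∑ y ∈ univ.erase w, M.dg S y) :=
        Finset.even_sum _ fun y hy => hev y (ne_of_mem_erase hy)
      rw [Nat.even_iff] at h2 ⊢
      omega
    · change Odd (M.cdg S χ true w)
      have h1 := hsum (S.filter fun e => χ e = true)
      have h2 : (∑ y ∈ univ.erase w, M.cdg S χ true y) % 2 = (∑ y ∈ univ.erase w, β y) % 2 :=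
        sum_mod_two _ fun y hy => (hχ y (ne_of_mem_erase hy)).2
      rw [Nat.odd_iff] at hβsum ⊢
      unfold cdg at h2 ⊢
      omega
  · exact (hχ x hx).1

/-- All edges at `w` get the color `true`, which is right at `w` since their number is odd. A
neighbor of odd total degree must then be monochromatic. One of even total degree gives the color
`false` to exactly one of its forest edges, and with two forest edges to choose from it can still
obey a prescription. A neighbor without this freedom must be the root `r`, unless it is isolated in
`H`. -/
theorem nearlyColorable_of_root [Fintype V] (hs : M.IsSplit w D H) (r : V)
    (hw : Odd (M.dg (M.star w D) w))
    (h : ∀ x ≠ w, 0 < M.dg (M.star w D) x →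
      Odd (M.dg H x + M.dg (M.star w D) x) ∧ (x = r ∨ M.dg H x = 0) ∨
      Even (M.dg H x + M.dg (M.star w D) x) ∧ (2 ≤ M.dg H x ∨ x = r ∧ 1 ≤ M.dg H x)) :
    M.NearlyColorable := by
  set S := M.star w D with hS
  have hHS : ∀ {e}, e ∈ H → e ∉ S := fun he => disjoint_left.1 hs.disjoint_star he
  have hdg : ∀ x, M.dg (H ∪ S) x = M.dg H x + M.dg S x := hs.dg_union_star
  have hsingle : ∀ x, Even (M.dg (H ∪ S) x) → ∀ g ∈ H, M.Inc g x →
      M.OddAt (H ∪ S) x (fun e => if e = g then false else !false) ∧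
      ∀ e ∈ S, M.Inc e x → (if e = g then false else !false) = true := fun x hx g hg hgx =>
    ⟨oddAt_single hx (mem_union_left _ hg) hgx false, fun e he _ => by
      rw [if_neg]; · rfl
      rintro rfl
      exact hHS hg he⟩
  obtain ⟨χ, hχ⟩ := hs.exists_coloring r
    (fun x χ => M.OddAt (H ∪ S) x χ ∧ ∀ e ∈ S, M.Inc e x → χ e = true)
    (fun v _ χ χ' hag h => ⟨h.1.congr hag, fun e he hi =>
      (hag e (mem_union_right _ he) hi).symm.trans (h.2 e he hi)⟩)
    (fun v hv => by
      rcases Nat.eq_zero_or_pos (M.dg S v) with h0 | h0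
      · obtain ⟨χ, hχ⟩ := M.exists_oddAt' (H ∪ S) v
        exact ⟨χ, hχ, fun e he hi => absurd hi (dg_eq_zero.1 h0 e he)⟩
      · rcases h v hv h0 with ⟨h1, -⟩ | ⟨h1, h2⟩
        · exact ⟨fun _ => true, oddAt_const (hdg v ▸ h1) true, fun _ _ _ => rfl⟩
        · obtain ⟨g, hg, hgv⟩ := M.dg_pos.1 (show 0 < M.dg H v by omega)
          exact ⟨_, hsingle v (hdg v ▸ h1) g hg hgv⟩)
    (fun v hv hvr f hf hfv c => by
      rcases Nat.eq_zero_or_pos (M.dg S v) with h0 | h0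
      · obtain ⟨χ, h1, hχ⟩ := exists_oddAt (mem_union_left S hf) hfv c
        exact ⟨χ, h1, hχ, fun e he hi => absurd hi (dg_eq_zero.1 h0 e he)⟩
      · have hpos : 0 < M.dg H v := dg_pos.2 ⟨f, hf, hfv⟩
        rcases h v hv h0 with ⟨-, h1⟩ | ⟨h1, h2⟩
        · exact absurd h1 (by simp [hvr, hpos.ne'])
        · have h2 : 2 ≤ M.dg H v := h2.resolve_right fun h => hvr h.1
          cases c
          · exact ⟨_, by simp, hsingle v (hdg v ▸ h1) f hf hfv⟩
          · have h3 := M.dg_erase hf v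
            rw [if_pos hfv] at h3
            obtain ⟨g, hg, hgv⟩ := dg_pos.1 (show 0 < M.dg (H.erase f) v by omega)
            rw [mem_erase] at hg
            exact ⟨_, by simp [hg.1.symm], hsingle v (hdg v ▸ h1) g hg.2 hgv⟩)
  refine hs.nearlyColorable (χ := χ) fun x => ?_
  by_cases hx : x = w
  · rw [hx]
    have h1 : M.cdg (H ∪ S) χ true w = M.dg S w := by
      refine dg_congr fun e he => ?_
      simp only [mem_filter, mem_union]
      constructor
      · rintro ⟨h | h, -⟩
        · exact absurd he (hs.not_inc h)
        · exact h
      · intro h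
        refine ⟨Or.inr h, ?_⟩
        obtain ⟨y, hl⟩ := he.exists_link
        exact (hχ y hl.ne.symm).2 e h hl.inc_right
    have h2 := M.cdg_add_cdg_not (H ∪ S) χ true w
    rw [hdg, hs.dg_self] at h2
    refine oddAt_of_cdg true (Or.inr (h1 ▸ hw)) (Or.inl ?_)
    change M.cdg (H ∪ S) χ (!true) w = 0
    omega
  · exact (hχ x hx).1

end IsSplit

end Coloring

/-! ### Even order, and cutting at a vertex into two pieces of even order. -/

section Decomposition

variable {V B : Type*} [DecidableEq V] {M : Multigraph V B}

variable (M) in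
/-- The edges with both ends in `W`. -/
def inside [Fintype B] (W : Finset V) : Finset B := univ.filter fun e => M.fst e ∈ W ∧ M.snd e ∈ W

theorem mem_of_inside [Fintype B] {W : Finset V} {e : B} (he : e ∈ M.inside W) (v : V) (hv : M.Inc e v) :
    v ∈ W := by
  simp only [inside, mem_filter, mem_univ, true_and] at he
  rcases hv with rfl | rfl
  · exact he.1
  · exact he.2

/-- The piece on `insert c X` is connected: a closed subset avoiding `c` is closed in the whole
graph, hence empty, and otherwise its complement in the piece is such a set. The piece has even
order because `X` has odd order. -/
theorem even_card_of_closed_inside [Fintype V] [Fintype B] (hconn : ∀ X, M.Closed univ X → X = ∅ ∨ X = univ)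
    {c : V} {X : Finset V} (hcX : c ∉ X) (hX : M.Closed (M.off c) X) (hodd : Odd X.card)
    (Z : Finset V) (hZX : Z ⊆ insert c X) (hZ : M.Closed (M.inside (insert c X)) Z) :
    Even Z.card := by
  have key : ∀ Z ⊆ insert c X, c ∉ Z → M.Closed (M.inside (insert c X)) Z → Z = ∅ := by
    intro Z hZX hcZ hZ
    refine (hconn Z (closed_of_link fun e _ x y hl hx => ?_)).resolve_right
      (by rintro rfl; exact hcZ (mem_univ _))
    have hxX : x ∈ X := (mem_insert.1 (hZX hx)).resolve_left (by rintro rfl; exact hcZ hx)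
    have hy : y ∈ insert c X := by
      by_cases hyc : y = c
      · simp [hyc]
      · refine mem_insert_of_mem ((hX.mem_iff (mem_off.2 ?_) hl).1 hxX)
        rw [hl.inc_iff]
        rintro (rfl | rfl)
        · exact hcX hxX
        · exact hyc rfl
    refine (hZ.mem_iff ?_ hl).1 hx
    have hx' : x ∈ insert c X := mem_insert_of_mem hxX
    simp only [inside, mem_filter, mem_univ, true_and]
    rcases hl with ⟨rfl, rfl⟩ | ⟨rfl, rfl⟩
    · exact ⟨hx', hy⟩
    · exact ⟨hy, hx'⟩
  by_cases hc : c ∈ Z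
  · have h1 := key (insert c X \ Z) sdiff_subset (by simp [hc]) (fun e he => by
      have h2 := hZ e he
      simp only [mem_sdiff, mem_of_inside he _ (Or.inl rfl), mem_of_inside he _ (Or.inr rfl),
        true_and]
      exact not_congr h2)
    rw [sdiff_eq_empty_iff_subset] at h1
    rw [hZX.antisymm h1, card_insert_of_notMem hcX]
    exact hodd.add_one
  · rw [key Z hZX hc hZ]
    simp

variable [DecidableEq B] [Fintype V]

theorem exists_odd_complement {S : Finset B} {W : Finset V}
    (hSW : ∀ e ∈ S, ∀ v, M.Inc e v → v ∈ W)
    (h : ∀ X ⊆ W, M.Closed S X → Even X.card) :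
    ∃ F ⊆ S, (∀ x ∈ W, Odd (M.dg (S \ F) x)) ∧ M.Acyclic F ∧
      ∀ e ∈ S, ∀ x y, M.Link e x y → (∀ f ∈ F, ¬ M.Link f x y) → M.Acyclic (insert e F) := by
  obtain ⟨F, hF, hd, hac, hins⟩ := exists_min_join (M := M) (S := S)
    (τ := fun v => if v ∈ W then M.dg S v + 1 else 0) (fun X hX => by
      have hXW : M.Closed S (X ∩ W) := fun e he => by
        simp only [mem_inter, hSW e he _ (Or.inl rfl), hSW e he _ (Or.inr rfl), and_true]
        exact hX e he
      rw [sum_ite, sum_const_zero, add_zero, filter_mem_eq_inter, sum_add_distrib]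
      refine (even_sum_dg hXW Subset.rfl).add ?_
      simpa using h _ inter_subset_right hXW)
  refine ⟨F, hF, fun x hx => ?_, hac, hins⟩
  have h1 := hd x
  have h2 := M.dg_sdiff hF x
  rw [if_pos hx] at h1
  rw [Nat.odd_iff]
  omega

/-- Rooting at `c` exempts `c` from oddness. Instead `true` occurs there at most once and `false`
evenly often, which is what gluing two pieces at `c` requires. -/
theorem exists_forest_coloring {F : Finset B} (hF : M.Acyclic F) (c : V) :
    ∃ χ, (∀ x ≠ c, M.OddAt F x χ) ∧ M.cdg F χ true c = M.dg F c % 2 := by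
  obtain ⟨χ, hχ⟩ := exists_coloring _ F F univ c
    (fun x χ => (x ≠ c → M.OddAt F x χ) ∧ (x = c → M.cdg F χ true c = M.dg F c % 2))
    rfl Subset.rfl hF (by simp) (fun e he h => absurd he h)
    (fun v _ χ χ' hag h => ⟨fun hv => (h.1 hv).congr hag, fun hv => by
      subst hv; rw [← h.2 rfl, cdg_congr fun e he hi => (hag e he hi).symm]⟩)
    (fun v _ => by
      by_cases hv : v = c
      · subst hv
        rcases Nat.mod_two_eq_zero_or_one (M.dg F v) with h | h
        · refine ⟨fun _ => false, fun h => absurd rfl h, fun _ => ?_⟩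
          have h1 := M.cdg_const F false v
          have h2 := M.cdg_add_cdg_not F (fun _ => false) false v
          rw [Bool.not_false] at h2
          omega
        · obtain ⟨g, hg, hgv⟩ := M.dg_pos.1 (show 0 < M.dg F v by omega)
          exact ⟨_, fun h => absurd rfl h, fun _ => by rw [cdg_single hg hgv true, h]⟩
      · obtain ⟨χ, h⟩ := M.exists_oddAt' F v
        exact ⟨χ, fun _ => h, fun h => absurd h hv⟩)
    (fun v _ hv f hf hfv b => by
      obtain ⟨χ, h1, h⟩ := exists_oddAt hf hfv b
      exact ⟨χ, h1, fun _ => h, fun h => absurd h hv⟩)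
  exact ⟨χ, fun x hx => (hχ x (mem_univ x)).1 hx, (hχ c (mem_univ c)).2 rfl⟩

variable [Fintype B]

theorem nearlyColorable_of_even_card (hconn : ∀ X, M.Closed univ X → X = ∅ ∨ X = univ)
    (heven : Even (Fintype.card V)) : M.NearlyColorable := by
  obtain ⟨F, -, hodd, hac, -⟩ := exists_odd_complement (M := M) (S := univ) (W := univ) (by simp)
    (fun X _ hX => by
      rcases hconn X hX with rfl | rfl
      · simp
      · simpa using heven)
  rcases isEmpty_or_nonempty V with hV | ⟨⟨r⟩⟩
  · exact ⟨∅, fun _ => 0, by simp, fun j v => hV.elim v⟩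
  obtain ⟨χ, hχ⟩ := exists_coloring _ F F univ r (fun x χ => M.OddAt F x χ) rfl Subset.rfl hac
    (by simp) (fun e he h => absurd he h) (fun v _ χ χ' hag h => h.congr hag)
    (fun v _ => exists_oddAt' _ _) (fun v _ _ f hf hfv c => exists_oddAt hf hfv c)
  exact nearlyColorable_of_oddAt (D := ∅) (H := F) (χ := χ) (by simp) (by simp)
    (fun x => Or.inr (by simpa using hodd x (mem_univ x))) fun x => hχ x (mem_univ x)

/-- The sets `insert c X` and `insert c Y` have even order, so each piece is an odd spanning part
plus a forest. The odd parts get colors 0 and 1. Each forest uses 2 and the color of the other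
piece's odd part. At `c` the forests contribute evenly to colors 0 and 1, which thus stay odd, and
each contributes at most one edge of color 2. -/
theorem nearlyColorable_of_cut (hconn : ∀ X, M.Closed univ X → X = ∅ ∨ X = univ)
    (hV : Odd (Fintype.card V)) {c : V} {X : Finset V} (hcX : c ∉ X) (hX : M.Closed (M.off c) X)
    (hodd : Odd X.card) : M.NearlyColorable := by
  set Y : Finset V := (insert c X)ᶜ with hY
  have hcY : c ∉ Y := by simp [hY]
  have hYX : ∀ x, x ∈ Y ↔ x ≠ c ∧ x ∉ X := fun x => by simp [hY]
  have hYcl : M.Closed (M.off c) Y := fun e he => by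
    have h1 := mem_off.1 he
    simp only [Inc, not_or] at h1
    simp only [hYX, ne_eq, h1, not_false_eq_true, true_and]
    exact not_congr (hX e he)
  have hYodd : Odd Y.card := by
    have := card_compl_add_card (insert c X)
    rw [← hY, card_insert_of_notMem hcX] at this
    rw [Nat.odd_iff] at *
    omega
  obtain ⟨F1, hF1, hodd1, hac1, -⟩ := exists_odd_complement
    (fun e he => mem_of_inside (M := M) (W := insert c X) he)
    (even_card_of_closed_inside hconn hcX hX hodd)
  obtain ⟨F2, hF2, hodd2, hac2, -⟩ := exists_odd_complement
    (fun e he => mem_of_inside (M := M) (W := insert c Y) he)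
    (even_card_of_closed_inside hconn hcY hYcl hYodd)
  -- Color 2 is even and nonzero at `c` only if both forests have odd degree there. Deleting one
  -- edge of `F2` at `c` prevents this.
  obtain ⟨D, hD, hDF, hle⟩ : ∃ D : Finset B, D.card ≤ 1 ∧ D ⊆ F2 ∧
      M.dg F1 c % 2 + M.dg (F2 \ D) c % 2 ≤ 1 := by
    by_cases h : M.dg F1 c % 2 + M.dg F2 c % 2 ≤ 1
    · exact ⟨∅, by simp, by simp, by simpa using h⟩
    · obtain ⟨e, he, hec⟩ := M.dg_pos.1 (show 0 < M.dg F2 c by omega)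
      have h1 := M.dg_erase he c
      rw [if_pos hec] at h1
      refine ⟨{e}, by simp, by simpa using he, ?_⟩
      rw [sdiff_singleton_eq_erase]
      omega
  obtain ⟨χ1, h1, hc1⟩ := exists_forest_coloring hac1 c
  obtain ⟨χ2, h2, hc2⟩ := exists_forest_coloring (hac2.mono (sdiff_subset (t := D))) c
  set S1 := M.inside (insert c X)
  set S2 := M.inside (insert c Y)
  have hS : ∀ e, e ∈ S1 ↔ e ∉ S2 := fun e => by
    have hne := M.ne e
    simp only [S1, S2, inside, mem_filter, mem_univ, true_and, mem_insert, hYX]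
    by_cases ha : M.fst e = c
    · simp only [ha] at hne ⊢
      simp only [true_or, true_and, hne.symm, false_or]
      tauto
    · by_cases hb : M.snd e = c
      · simp only [hb] at ha ⊢
        tauto
      · have := hX e (mem_off.2 (by simp [Inc, ha, hb]))
        tauto
  have hF12 : ∀ e ∈ F1, e ∉ F2 := fun e he h => (hS e).1 (hF1 he) (hF2 h)
  have hin1 : ∀ e ∈ S1, e ∉ S2 ∧ e ∉ F2 ∧ e ∉ D := fun e he =>
    ⟨(hS e).1 he, fun h => (hS e).1 he (hF2 h), fun h => (hS e).1 he (hF2 (hDF h))⟩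
  have hin2 : ∀ e ∉ S1, e ∈ S2 ∧ e ∉ F1 := fun e he =>
    ⟨by_contra fun h => he ((hS e).2 h), fun h => he (hF1 h)⟩
  let φ : B → Fin 3 := fun e =>
    if e ∈ S1 then (if e ∈ F1 then (if χ1 e then 2 else 1) else 0)
    else (if e ∈ F2 then (if χ2 e then 2 else 0) else 1)
  have c0 : (univ.filter fun e => e ∉ D ∧ φ e = 0) =
      (S1 \ F1) ∪ (F2 \ D).filter fun e => χ2 e = false := by
    ext e
    simp only [φ, mem_filter, mem_univ, true_and, mem_union, mem_sdiff]
    by_cases b : e ∈ S1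
    · obtain ⟨b1, b2, b3⟩ := hin1 e b
      by_cases b4 : e ∈ F1 <;> cases χ1 e <;> simp [b, b2, b3, b4]
    · obtain ⟨b1, b2⟩ := hin2 e b
      by_cases b3 : e ∈ D
      · simp [b, b2, b3, hDF b3]
      · by_cases b4 : e ∈ F2 <;> cases χ2 e <;> simp [b, b2, b3, b4]
  have c1 : (univ.filter fun e => e ∉ D ∧ φ e = 1) =
      (F1.filter fun e => χ1 e = false) ∪ (S2 \ F2) := by
    ext e
    simp only [φ, mem_filter, mem_univ, true_and, mem_union, mem_sdiff]
    by_cases b : e ∈ S1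
    · obtain ⟨b1, b2, b3⟩ := hin1 e b
      by_cases b4 : e ∈ F1 <;> cases χ1 e <;> simp [b, b1, b2, b3, b4]
    · obtain ⟨b1, b2⟩ := hin2 e b
      by_cases b3 : e ∈ D
      · simp [b, b1, b2, b3, hDF b3]
      · by_cases b4 : e ∈ F2 <;> cases χ2 e <;> simp [b, b1, b2, b3, b4]
  have c2 : (univ.filter fun e => e ∉ D ∧ φ e = 2) =
      (F1.filter fun e => χ1 e = true) ∪ (F2 \ D).filter fun e => χ2 e = true := by
    ext e
    simp only [φ, mem_filter, mem_univ, true_and, mem_union, mem_sdiff]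
    by_cases b : e ∈ S1
    · obtain ⟨b1, b2, b3⟩ := hin1 e b
      by_cases b4 : e ∈ F1 <;> cases χ1 e <;> simp [b, b2, b3, b4]
    · obtain ⟨b1, b2⟩ := hin2 e b
      by_cases b3 : e ∈ D
      · simp [b, b2, b3, hDF b3]
      · by_cases b4 : e ∈ F2 <;> cases χ2 e <;> simp [b, b2, b3, b4]
  have d0 : ∀ x, M.dg (univ.filter fun e => e ∉ D ∧ φ e = 0) x =
      M.dg (S1 \ F1) x + M.cdg (F2 \ D) χ2 false x := fun x => by
    rw [c0, dg_union]; · rfl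
    refine disjoint_left.2 fun e he he' => ?_
    simp only [mem_sdiff, mem_filter] at he he'
    exact (hS e).1 he.1 (hF2 he'.1.1)
  have d1 : ∀ x, M.dg (univ.filter fun e => e ∉ D ∧ φ e = 1) x =
      M.cdg F1 χ1 false x + M.dg (S2 \ F2) x := fun x => by
    rw [c1, dg_union]; · rfl
    refine disjoint_left.2 fun e he he' => ?_
    simp only [mem_sdiff, mem_filter] at he he'
    exact (hS e).1 (hF1 he.1) he'.1
  have d2 : ∀ x, M.dg (univ.filter fun e => e ∉ D ∧ φ e = 2) x =
      M.cdg F1 χ1 true x + M.cdg (F2 \ D) χ2 true x := fun x => by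
    rw [c2, dg_union]; · rfl
    refine disjoint_left.2 fun e he he' => ?_
    simp only [mem_sdiff, mem_filter] at he he'
    exact hF12 e he.1 he'.1.1
  have z1 : ∀ x ∉ insert c X, ∀ F ⊆ S1, M.dg F x = 0 := fun x hx F hF =>
    dg_eq_zero.2 fun e he hi => hx (mem_of_inside (hF he) x hi)
  have z2 : ∀ x ∉ insert c Y, ∀ F ⊆ S2, M.dg F x = 0 := fun x hx F hF =>
    dg_eq_zero.2 fun e he hi => hx (mem_of_inside (hF he) x hi)
  have hF2D : F2 \ D ⊆ S2 := sdiff_subset.trans hF2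
  refine ⟨D, φ, hD, fun j x => ?_⟩
  by_cases hxc : x = c
  · subst hxc
    have e1 := M.cdg_add_cdg_not F1 χ1 true x
    have e2 := M.cdg_add_cdg_not (F2 \ D) χ2 true x
    have o1 := hodd1 x (mem_insert_self _ _)
    have o2 := hodd2 x (mem_insert_self _ _)
    rw [Nat.odd_iff] at o1 o2
    rw [Bool.not_true] at e1 e2
    fin_cases j
    · change M.dg (univ.filter fun e => e ∉ D ∧ φ e = 0) x = 0 ∨
        Odd (M.dg (univ.filter fun e => e ∉ D ∧ φ e = 0) x)
      rw [d0, Nat.odd_iff]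
      omega
    · change M.dg (univ.filter fun e => e ∉ D ∧ φ e = 1) x = 0 ∨
        Odd (M.dg (univ.filter fun e => e ∉ D ∧ φ e = 1) x)
      rw [d1, Nat.odd_iff]
      omega
    · change M.dg (univ.filter fun e => e ∉ D ∧ φ e = 2) x = 0 ∨
        Odd (M.dg (univ.filter fun e => e ∉ D ∧ φ e = 2) x)
      rw [d2, Nat.odd_iff]
      omega
  · by_cases hx : x ∈ X
    · have hxY : x ∉ insert c Y := by simp [hxc, hYX, hx]
      have y1 : ∀ b, M.cdg (F2 \ D) χ2 b x = 0 := fun b =>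
        z2 x hxY _ ((filter_subset _ _).trans hF2D)
      have y2 := z2 x hxY _ (sdiff_subset (s := S2) (t := F2))
      have q0 := d0 x
      have q1 := d1 x
      have q2 := d2 x
      rw [y1, add_zero] at q0 q2
      rw [y2, add_zero] at q1
      fin_cases j
      · exact q0 ▸ Or.inr (hodd1 x (mem_insert_of_mem hx))
      · exact q1 ▸ h1 x hxc false
      · exact q2 ▸ h1 x hxc true
    · have hxX : x ∉ insert c X := by simp [hxc, hx]
      have hxY : x ∈ insert c Y := by simp [hYX, hxc, hx]
      have y1 : ∀ b, M.cdg F1 χ1 b x = 0 := fun b =>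
        z1 x hxX _ ((filter_subset _ _).trans hF1)
      have y2 := z1 x hxX _ (sdiff_subset (s := S1) (t := F1))
      have q0 := d0 x
      have q1 := d1 x
      have q2 := d2 x
      rw [y1, zero_add] at q1 q2
      rw [y2, zero_add] at q0
      fin_cases j
      · exact q0 ▸ h2 x hxc false
      · exact q1 ▸ Or.inr (hodd2 x hxY)
      · exact q2 ▸ h2 x hxc true

end Decomposition

/-! ### Critical graphs: multiplicities, cut vertices and exchange of parallel edges. -/

section Critical

variable {V B : Type*} {M : Multigraph V B}

variable (M) in
/-- Some edge joins `x` and `y`. -/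
def Adj (x y : V) : Prop := ∃ e, M.Link e x y

theorem Adj.symm {x y : V} (h : M.Adj x y) : M.Adj y x := h.imp fun _ h => h.symm

theorem Adj.ne {x y : V} (h : M.Adj x y) : x ≠ y := h.elim fun _ h => h.ne

variable [DecidableEq V] [Fintype B]

variable (M) in
/-- The number of edges joining `x` and `y`, provided that `x ≠ y`. -/
def mult (x y : V) : ℕ := M.dg (univ.filter fun e => M.Inc e x) y

theorem mult_comm (x y : V) : M.mult x y = M.mult y x := by
  unfold mult dg
  rw [filter_filter, filter_filter]
  simp_rw [and_comm]

theorem mult_self (x : V) : M.mult x x = M.dg univ x := by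
  simp [mult, dg, filter_filter]

theorem mult_pos {x y : V} (hxy : x ≠ y) : 0 < M.mult x y ↔ M.Adj x y := by
  simp only [mult, dg_pos, mem_filter, mem_univ, true_and]
  exact exists_congr fun e => ⟨fun h => link_of_inc h.1 h.2 hxy,
    fun h => ⟨h.inc_left, h.inc_right⟩⟩

theorem exists_pair_of_even {x y : V} (h : M.Adj x y) (hev : Even (M.mult x y)) :
    ∃ e e', e ≠ e' ∧ M.Link e x y ∧ M.Link e' x y := by
  have h1 := (mult_pos h.ne).2 h
  rw [Nat.even_iff] at hev
  have h2 : 1 < M.mult x y := by omega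
  obtain ⟨e, he, e', he', hne⟩ := one_lt_card.1 h2
  simp only [mem_filter, mem_univ, true_and] at he he'
  exact ⟨e, e', hne, link_of_inc he.1 he.2 h.ne, link_of_inc he'.1 he'.2 h.ne⟩

theorem dg_off_add_mult (w x : V) : M.dg (M.off w) x + M.mult w x = M.dg univ x := by
  have := M.dg_filter_add univ (fun e => M.Inc e w) x
  unfold mult off
  omega

theorem even_sum_mult [Fintype V] (w : V) :
    Even (M.dg univ w + ∑ x ∈ univ.erase w, M.mult w x) := by
  rw [← mult_self, add_sum_erase _ _ (mem_univ w)]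
  exact even_sum_dg (S := univ) (by simp [Closed]) (subset_univ _)

variable [DecidableEq B]

theorem dg_star (w x : V) : M.dg (M.star w ∅) x = M.mult w x := by
  simp [star, mult]

theorem star_eq {w : V} {D : Finset B} (hD : D ⊆ M.off w) : M.star w D = M.star w ∅ := by
  ext e
  simp only [mem_star, notMem_empty, not_false_eq_true, and_true, and_iff_left_iff_imp]
  exact fun h h' => mem_off.1 (hD h') h

theorem isSplit_sdiff {w : V} {F D : Finset B} (hF : F ⊆ M.off w) (hac : M.Acyclic F)
    (hodd : ∀ x ≠ w, Odd (M.dg (M.off w \ F) x)) (hD : D.card ≤ 1) (hDF : D ⊆ F) :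
    M.IsSplit w D (F \ D) where
  card_le := hD
  disj := disjoint_sdiff
  subset := sdiff_subset.trans hF
  acyclic := hac.mono sdiff_subset
  odd := by rwa [sdiff_union_of_subset hDF]

theorem isSplit_erase {w : V} {F : Finset B} {e : B} (hF : F ⊆ M.off w) (hac : M.Acyclic F)
    (hodd : ∀ x ≠ w, Odd (M.dg (M.off w \ F) x)) (he : e ∈ F) :
    M.IsSplit w {e} (F.erase e) := by
  rw [← sdiff_singleton_eq_erase]
  exact isSplit_sdiff hF hac hodd (by simp) (by simpa using he)

theorem isSplit_self {w : V} {F : Finset B} (hF : F ⊆ M.off w) (hac : M.Acyclic F)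
    (hodd : ∀ x ≠ w, Odd (M.dg (M.off w \ F) x)) : M.IsSplit w ∅ F := by
  simpa using isSplit_sdiff (D := ∅) hF hac hodd (by simp) (by simp)

/-- The deleted edge is at `w`, so the odd part does not notice; the purpose is to change the parity
of the degree of `w`. -/
theorem isSplit_star {w : V} {F : Finset B} {e : B} (hF : F ⊆ M.off w) (hac : M.Acyclic F)
    (hodd : ∀ x ≠ w, Odd (M.dg (M.off w \ F) x)) (he : M.Inc e w) : M.IsSplit w {e} F where
  card_le := by simp
  disj := disjoint_singleton_left.2 fun h => mem_off.1 (hF h) he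
  subset := hF
  acyclic := hac
  odd x hx := by
    convert hodd x hx using 2
    ext f
    simp only [mem_sdiff, mem_union, mem_singleton, not_or, mem_off]
    refine ⟨fun h => ⟨h.1, h.2.1⟩, fun h => ⟨h.1, h.2, ?_⟩⟩
    rintro rfl
    exact h.1 he

/-- The parallel edges `e` and `e'` leave the odd part together, so no parity changes there. One
enters the forest and the other is the deleted edge. -/
theorem isSplit_insert {w x y : V} {F : Finset B} {e e' : B} (hF : F ⊆ M.off w)
    (hac : M.Acyclic (insert e F)) (hodd : ∀ x ≠ w, Odd (M.dg (M.off w \ F) x))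
    (hne : e ≠ e') (he : M.Link e x y) (he' : M.Link e' x y) (hew : e ∈ M.off w)
    (heF : e ∉ F) (heF' : e' ∉ F) : M.IsSplit w {e'} (insert e F) where
  card_le := by simp
  disj := by simp [hne.symm, heF']
  subset := insert_subset hew hF
  acyclic := hac
  odd z hz := by
    have hew' : e' ∈ M.off w := by
      rw [mem_off, he'.inc_iff, ← he.inc_iff]; exact mem_off.1 hew
    have h1 : insert e F ∪ {e'} = insert e' (insert e F) := by
      ext; simp; tauto
    have hs : insert e' (insert e F) ⊆ M.off w := insert_subset hew' (insert_subset hew hF)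
    have h2 := M.dg_sdiff hs z
    have h3 := M.dg_sdiff hF z
    have h4 := hodd z hz
    rw [dg_insert (by simp [heF', hne.symm]), dg_insert heF] at h2
    simp only [he.inc_iff, he'.inc_iff] at h2
    rw [h1]
    rw [Nat.odd_iff] at *
    split_ifs at h2 <;> omega

theorem dg_mod {w x : V} {F : Finset B} (hF : F ⊆ M.off w)
    (hodd : Odd (M.dg (M.off w \ F) x)) :
    M.dg F x % 2 = (M.dg univ x + M.mult w x + 1) % 2 := by
  have h1 := M.dg_sdiff hF x
  have h2 := M.dg_off_add_mult w x
  rw [Nat.odd_iff] at hodd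
  omega

variable [Fintype V]

variable (M) in
/-- A connected graph that is not nearly 3-colorable and in which every vertex-deleted subgraph
has only components of even order. -/
structure IsCritical : Prop where
  not_nearly : ¬ M.NearlyColorable
  conn : ∀ X, M.Closed univ X → X = ∅ ∨ X = univ
  even : ∀ w X, w ∉ X → M.Closed (M.off w) X → Even X.card

namespace IsCritical

theorem exists_split (hM : M.IsCritical) (w : V) :
    ∃ F ⊆ M.off w, (∀ x ≠ w, Odd (M.dg (M.off w \ F) x)) ∧ M.Acyclic F ∧
      ∀ e ∈ M.off w, ∀ x y, M.Link e x y → (∀ f ∈ F, ¬ M.Link f x y) →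
        M.Acyclic (insert e F) := by
  obtain ⟨F, hF, hodd, h⟩ := exists_odd_complement (M := M) (S := M.off w) (W := univ.erase w)
    (fun e he v hv => mem_erase.2 ⟨by rintro rfl; exact mem_off.1 he hv, mem_univ _⟩)
    (fun X hX hcl => hM.even w X (fun h => notMem_erase _ _ (hX h)) hcl)
  exact ⟨F, hF, fun x hx => hodd x (mem_erase.2 ⟨hx, mem_univ _⟩), h⟩

/-- If `nearlyColorable_of_closed` never applies, the multiplicities at `w` sum to an even number
over each component of `F \ D`, so their parities are realized by a join inside `F \ D`. An odd
multiplicity makes the join in `F` nonempty. Deleting one of its edges `e` leaves another join with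
the same parities, but joins in a forest are unique. -/
theorem even_mult (hM : M.IsCritical) {w x : V} (hw : Even (M.dg univ w)) (hx : x ≠ w) :
    Even (M.mult w x) := by
  by_contra hodd
  rw [Nat.not_even_iff_odd] at hodd
  obtain ⟨F, hF, hFodd, hac, -⟩ := hM.exists_split w
  obtain ⟨D, hD, hDF, K, hK, hwK, hsum⟩ : ∃ D : Finset B, D.card ≤ 1 ∧ D ⊆ F ∧ ∃ K,
      M.Closed (F \ D) K ∧ w ∉ K ∧ Odd (∑ x ∈ K, M.mult w x) := by
    by_contra! hc
    have hjoin : ∀ D : Finset B, D.card ≤ 1 → D ⊆ F → ∃ J ⊆ F \ D, ∀ v, M.dg J v % 2 =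
        (if v = w then 0 else M.mult w v) % 2 := fun D hD hDF => exists_join fun X hX => by
      have h1 := hc D hD hDF (X.erase w) (fun e he => by
        have : ¬ M.Inc e w := mem_off.1 (hF (sdiff_subset he))
        simp only [Inc, not_or] at this
        simpa [this] using hX e he) (notMem_erase _ _)
      rw [Nat.not_odd_iff_even] at h1
      convert h1 using 1
      rw [sum_ite, sum_const_zero, zero_add]
      congr 1
      ext; simp [and_comm]
    obtain ⟨J, hJ, hJd⟩ := hjoin ∅ (by simp) (by simp)
    rw [sdiff_empty] at hJ
    have hJx := hJd x
    rw [if_neg hx] at hJx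
    rw [Nat.odd_iff] at hodd
    obtain ⟨e, he, -⟩ := M.dg_pos.1 (show 0 < M.dg J x by omega)
    obtain ⟨J', hJ', hJd'⟩ := hjoin {e} (by simp) (by simpa using hJ he)
    have h1 := hac (symmDiff J J') (fun a ha => by
      rw [mem_symmDiff] at ha
      rcases ha with ha | ha
      · exact hJ ha.1
      · exact sdiff_subset (hJ' ha.1)) (fun v => by
        have a1 := M.dg_symmDiff J J' v
        have a2 := hJd v
        have a3 := hJd' v
        rw [Nat.even_iff]
        omega)
    rw [symmDiff_eq_bot.1 h1] at he
    exact (mem_sdiff.1 (hJ' he)).2 (mem_singleton_self e)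
  have hs := isSplit_sdiff hF hac hFodd hD hDF
  have hst := star_eq (hDF.trans hF)
  refine hM.not_nearly (hs.nearlyColorable_of_closed ?_ hK hwK ?_)
  · rwa [hst, dg_star, mult_self]
  · simpa only [hst, dg_star] using hsum

/-- A vertex of odd degree is not a cut vertex. Otherwise one side receives oddly many edges from
`v`. Deleting an edge from `v` to the other side makes the degree of `v` even, and
`nearlyColorable_of_closed` applies to the first side. -/
theorem eq_empty_or_of_closed (hM : M.IsCritical) {v : V} (hv : Odd (M.dg univ v)) {X : Finset V}
    (hvX : v ∉ X) (hX : M.Closed (M.off v) X) : X = ∅ ∨ X = univ.erase v := by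
  obtain ⟨F, hF, hFodd, hac, -⟩ := hM.exists_split v
  have key : ∀ X Y : Finset V, v ∉ X → v ∉ Y → M.Closed (M.off v) X → M.Closed (M.off v) Y →
      Disjoint X Y → Odd (∑ x ∈ X, M.mult v x) → Y = ∅ := by
    intro X Y hvX hvY hX hY hXY hodd
    by_contra hne
    obtain ⟨e, he, y, hy, hl⟩ : ∃ e, M.Inc e v ∧ ∃ y ∈ Y, M.Link e v y := by
      by_contra! hc
      rcases hM.conn Y (closed_of_link fun e _ x y hl hx => by
        by_cases hev : M.Inc e v
        · rcases (hl.inc_iff v).1 hev with rfl | rfl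
          · exact absurd hx hvY
          · exact absurd hl.symm (hc e hev x hx)
        · exact (hY.mem_iff (mem_off.2 hev) hl).1 hx) with h | h
      · exact hne h
      · exact hvY (h ▸ mem_univ v)
    have hs := isSplit_star hF hac hFodd he
    have hst : M.star v {e} = (M.star v ∅).erase e := by
      ext f; simp [mem_star, and_comm]
    have h1 := M.dg_erase (F := M.star v ∅) (e := e) (by simp [mem_star, he])
    refine hM.not_nearly (hs.nearlyColorable_of_closed ?_ (hX.mono hF) hvX ?_)
    · have h2 := h1 v
      rw [if_pos he, dg_star, mult_self] at h2
      rw [hst]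
      rw [Nat.odd_iff] at hv
      rw [Nat.even_iff]
      omega
    · rw [sum_congr rfl fun x hx => ?_]
      · exact hodd
      have h2 := h1 x
      rw [dg_star, if_neg] at h2
      · rw [hst]; exact h2
      · rw [hl.inc_iff]
        rintro (rfl | rfl)
        · exact hvX hx
        · exact disjoint_left.1 hXY hx hy
  let Y := univ.erase v \ X
  have hY : M.Closed (M.off v) Y := fun e he => by
    have h1 := mem_off.1 he
    simp only [Inc, not_or] at h1
    simp only [Y, mem_sdiff, mem_erase, mem_univ, and_true, ne_eq, h1, not_false_eq_true, true_and]
    exact not_congr (hX e he)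
  have hvY : v ∉ Y := by simp [Y]
  have hXY : Disjoint X Y := disjoint_sdiff
  have hXs : X ⊆ univ.erase v := fun x hx =>
    mem_erase.2 ⟨by rintro rfl; exact hvX hx, mem_univ _⟩
  have h1 := M.even_sum_mult v
  rw [← sum_sdiff hXs] at h1
  change Even (M.dg univ v + (∑ x ∈ Y, M.mult v x + _)) at h1
  rcases Nat.even_or_odd (∑ x ∈ X, M.mult v x) with he | ho
  · left
    refine key Y X hvY hvX hY hX hXY.symm ?_
    rw [Nat.even_iff] at h1 he
    rw [Nat.odd_iff] at hv ⊢
    omega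
  · right
    exact hXs.antisymm (sdiff_eq_empty_iff_subset.1 (key X Y hvX hvY hX hY hXY ho))

/-- The degrees of a forest that splits the graph at a vertex all of whose edges have even
multiplicity. -/
theorem dg_eq_zero_of_even (hM : M.IsCritical) {w x : V} (hw : Even (M.dg univ w)) {D H : Finset B}
    (hs : M.IsSplit w D H) (hD : D ⊆ M.off w) (hx : M.Adj w x) (hev : Even (M.dg H x)) :
    M.dg H x = 0 := by
  by_contra h
  refine hM.not_nearly (hs.nearlyColorable_of_even (fun y hy => ?_)
    (Or.inl ⟨x, hx.ne.symm, ?_, Nat.pos_of_ne_zero h, hev⟩))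
  · rw [star_eq hD, dg_star]; exact hM.even_mult hw hy
  · rw [star_eq hD, dg_star]; exact (mult_pos hx.ne).2 hx

/-- If `y` is not a neighbor of `w`, then `x` is isolated in `H`, since otherwise `x` has positive
even degree in `H` or in `insert f H`. Hence inserting `f` changes the number of isolated neighbors
of `w` by exactly one, and for one of the two forests it is odd, against `nearlyColorable_of_even`.
-/
theorem adj_of_insert (hM : M.IsCritical) {w x y : V} (hw : Even (M.dg univ w))
    {D D' H : Finset B} {f : B} (hs : M.IsSplit w D H) (hs' : M.IsSplit w D' (insert f H))
    (hD : D ⊆ M.off w) (hD' : D' ⊆ M.off w) (hfH : f ∉ H) (hf : M.Link f x y)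
    (hx : M.Adj w x) : M.Adj w y := by
  by_contra hy
  have hyw : y ≠ w := by
    rintro rfl
    exact mem_off.1 (hs'.subset (mem_insert_self f H)) hf.inc_right
  have hdx := M.dg_insert hfH x
  rw [if_pos hf.inc_left] at hdx
  have hx0 : M.dg H x = 0 := by
    rcases Nat.even_or_odd (M.dg H x) with he | ho
    · exact hM.dg_eq_zero_of_even hw hs hD hx he
    · have := hM.dg_eq_zero_of_even hw hs' hD' hx (by rw [hdx]; exact ho.add_one)
      omega
  have key : ∀ D H : Finset B, M.IsSplit w D H → D ⊆ M.off w →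
      Even (univ.filter fun x => x ≠ w ∧ 0 < M.mult w x ∧ M.dg H x = 0).card := by
    intro D H hs hD
    rw [← Nat.not_odd_iff_even]
    intro h
    refine hM.not_nearly (hs.nearlyColorable_of_even (fun y hy => ?_) (Or.inr ?_))
    · rw [star_eq hD, dg_star]; exact hM.even_mult hw hy
    · simpa only [star_eq hD, dg_star] using h
  have h1 := key D H hs hD
  have h2 := key D' _ hs' hD'
  have h3 : (univ.filter fun x => x ≠ w ∧ 0 < M.mult w x ∧ M.dg H x = 0) =
      insert x (univ.filter fun x => x ≠ w ∧ 0 < M.mult w x ∧ M.dg (insert f H) x = 0) := by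
    ext z
    simp only [mem_filter, mem_univ, true_and, mem_insert]
    by_cases hzx : z = x
    · subst hzx
      simp [hx0, hx.ne.symm, (mult_pos hx.ne).2 hx]
    · simp only [hzx, false_or, and_congr_right_iff]
      intro hzw hpos
      have hzy : z ≠ y := by
        rintro rfl
        exact hy ((mult_pos hzw.symm).1 hpos)
      have := M.dg_insert hfH z
      rw [if_neg (by rw [hf.inc_iff]; tauto)] at this
      omega
  rw [h3, card_insert_of_notMem (by simp [hdx]), Nat.even_add_one] at h1
  exact h1 h2

/-- A forest edge joining `x` and `y` can be deleted. If there is none, one parallel edge can be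
inserted while the other is deleted. Either way two splits differ by an edge between `x` and `y`, as
`adj_of_insert` requires. -/
theorem adj_of_pair (hM : M.IsCritical) {w x y : V} (hw : Even (M.dg univ w)) (hx : M.Adj w x)
    (hyw : y ≠ w) {e e' : B} (hne : e ≠ e') (he : M.Link e x y) (he' : M.Link e' x y) :
    M.Adj w y := by
  obtain ⟨F, hF, hFodd, hac, hins⟩ := hM.exists_split w
  by_cases h : ∃ f ∈ F, M.Link f x y
  · obtain ⟨f, hf, hfl⟩ := h
    refine hM.adj_of_insert hw (isSplit_erase hF hac hFodd hf)
      (by rw [insert_erase hf]; exact isSplit_self hF hac hFodd) (by simpa using hF hf)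
      (empty_subset _) (notMem_erase _ _) hfl hx
  · push Not at h
    have hew : ∀ e, M.Link e x y → e ∈ M.off w := fun e he => by
      rw [mem_off, he.inc_iff]
      rintro (h | h)
      · exact hx.ne h
      · exact hyw h.symm
    exact hM.adj_of_insert hw (isSplit_self hF hac hFodd)
      (isSplit_insert hF (hins e (hew e he) x y he h) hFodd hne he he' (hew e he)
        (fun h' => h e h' he) (fun h' => h e' h' he'))
      (empty_subset _) (by simpa using hew e' he') (fun h' => h e h' he) he hx

end IsCritical

end Critical

/-! ### Critical graphs of odd order are Shannon triangles. -/

section Structure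

variable {V B : Type*} [DecidableEq V] [Fintype V] [DecidableEq B] [Fintype B] {M : Multigraph V B}

variable (M) in
/-- Three vertices, pairwise adjacent, two of the multiplicities being even. -/
def IsShannon : Prop := ∃ x y z : V, x ≠ y ∧ x ≠ z ∧ y ≠ z ∧ (∀ v, v = x ∨ v = y ∨ v = z) ∧
  M.Adj x y ∧ M.Adj x z ∧ M.Adj y z ∧ Even (M.mult x y) ∧ Even (M.mult x z)

namespace IsCritical

/-- For a neighbor of `w`, the degree in a splitting forest has parity opposite to the degree in the
graph, and an even forest degree must be zero. So `u` has odd forest degree, which deleting an edge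
shows to be 1; the other end of that edge is `u'`. A further neighbor would be joined by a parallel
pair, and inserting one of these edges would raise the forest degree to 2. -/
theorem exists_partner (hM : M.IsCritical) {w u : V} (hw : Even (M.dg univ w)) (hu : M.Adj w u)
    (hue : Even (M.dg univ u)) :
    ∃ u', M.Adj w u' ∧ M.Adj u u' ∧ (∀ v, M.Adj u v → v = w ∨ v = u') ∧
      ∀ v, M.Adj u' v → v = w ∨ v = u := by
  obtain ⟨F, hF, hFodd, hac, hins⟩ := hM.exists_split w
  have hpar : ∀ x, M.Adj w x → M.dg F x % 2 = (M.dg univ x + 1) % 2 := fun x hx => by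
    have h1 := dg_mod hF (hFodd x hx.ne.symm)
    have h2 := Nat.even_iff.1 (hM.even_mult hw hx.ne.symm)
    omega
  have hFu := hpar u hu
  rw [Nat.even_iff] at hue
  obtain ⟨e, he, heu⟩ := M.dg_pos.1 (show 0 < M.dg F u by omega)
  obtain ⟨u', hl⟩ := heu.exists_link
  have hsF := isSplit_self hF hac hFodd
  have hse := isSplit_erase hF hac hFodd he
  have heo : {e} ⊆ M.off w := by simpa using hF he
  have hwu' : M.Adj w u' := hM.adj_of_insert hw hse (by rwa [insert_erase he]) heo
    (empty_subset _) (notMem_erase _ _) hl hu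
  have hone : ∀ x, M.Adj w x → M.Inc e x → Odd (M.dg F x) → M.dg F x = 1 := by
    intro x hx hi hodd
    have h1 := M.dg_erase he x
    rw [if_pos hi] at h1
    have h2 := hM.dg_eq_zero_of_even hw hse heo hx (by
      rw [Nat.odd_iff] at hodd
      rw [Nat.even_iff]
      omega)
    omega
  have hnbr : ∀ x y, M.Link e x y → M.Adj w x → Even (M.dg univ x) → ∀ v, M.Adj x v →
      v = w ∨ v = y := by
    intro x y hxy hx hxe v hv
    by_contra! hc
    have hFx : M.dg F x = 1 := hone x hx hxy.inc_left (by
      have := hpar x hx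
      rw [Nat.even_iff] at hxe
      rw [Nat.odd_iff]
      omega)
    have huniq : ∀ f ∈ F, M.Inc f x → f = e := fun f hf hi =>
      card_le_one.1 hFx.le f (by simp [hf, hi]) e (by simp [he, hxy.inc_left])
    obtain ⟨f, f', hne, hf, hf'⟩ := exists_pair_of_even hv (hM.even_mult hxe hv.ne.symm)
    have hnotF : ∀ f ∈ F, ¬ M.Link f x v := fun f hf hfl => by
      have := huniq f hf hfl.inc_left
      subst this
      rcases (hxy.inc_iff v).1 hfl.inc_right with h | h
      · exact hv.ne h.symm
      · exact hc.2 h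
    have hoff : ∀ f, M.Link f x v → f ∈ M.off w := fun f hf => by
      rw [mem_off, hf.inc_iff]
      rintro (h | h)
      · exact hx.ne h
      · exact hc.1 h.symm
    have hs := isSplit_insert hF (hins f (hoff f hf) x v hf hnotF) hFodd hne hf hf' (hoff f hf)
      (fun h => hnotF f h hf) (fun h => hnotF f' h hf')
    have h1 := M.dg_insert (fun h => hnotF f h hf) x
    rw [if_pos hf.inc_left, hFx] at h1
    have h2 := hM.dg_eq_zero_of_even hw hs (by simpa using hoff f' hf') hx (by rw [h1]; decide)
    omega
  refine ⟨u', hwu', ⟨e, hl⟩, hnbr u u' hl hu (Nat.even_iff.2 hue), hnbr u' u hl.symm hwu' ?_⟩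
  have h1 := hpar u' hwu'
  rw [Nat.even_iff]
  by_contra h2
  have h3 := hM.dg_eq_zero_of_even hw hsF (empty_subset _) hwu' (Nat.even_iff.2 (by omega))
  exact dg_eq_zero.1 h3 e he hl.inc_right

/-- The partner of `u` seen from `w` and that of `w` seen from `u` coincide, so the three vertices
have no neighbors outside. -/
theorem isShannon_of_even (hM : M.IsCritical) {w u : V} (hw : Even (M.dg univ w))
    (hwu : M.Adj w u) (hu : Even (M.dg univ u)) : M.IsShannon := by
  obtain ⟨u', hwu', huu', h1, h2⟩ := hM.exists_partner hw hwu hu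
  obtain ⟨w', huw', hww', h3, -⟩ := hM.exists_partner hu hwu.symm hw
  obtain rfl : w' = u' := (h1 w' huw').resolve_left hww'.ne.symm
  refine ⟨w, u, w', hwu.ne, hwu'.ne, huu'.ne, fun v => ?_, hwu, hwu', huu',
    hM.even_mult hw hwu.ne.symm, hM.even_mult hw hwu'.ne.symm⟩
  have : ({w, u, w'} : Finset V) = univ := by
    refine (hM.conn _ (closed_of_link fun e _ x y hl hx => ?_)).resolve_left (by simp)
    simp only [mem_insert, mem_singleton] at hx ⊢
    rcases hx with rfl | rfl | rfl
    · exact Or.inr (h3 y ⟨e, hl⟩)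
    · rcases h1 y ⟨e, hl⟩ with h | h <;> simp [h]
    · rcases h2 y ⟨e, hl⟩ with h | h <;> simp [h]
  simpa using Finset.ext_iff.1 this v

/-- Two neighbors, other than `w`, of a neighbor `u` of `w` lie in distinct components of
`M - w - u`. -/
theorem exists_separation (hM : M.IsCritical) {w u v₁ v₂ : V} (hw : Even (M.dg univ w))
    (hwu : M.Adj w u) (hu : Odd (M.dg univ u)) (h₁ : M.Adj u v₁) (h₂ : M.Adj u v₂) (h₁w : v₁ ≠ w)
    (h₂w : v₂ ≠ w) (h₁₂ : v₁ ≠ v₂) :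
    ∃ X, M.Closed ((M.off w).filter fun e => ¬ M.Inc e u) X ∧ v₁ ∈ X ∧ v₂ ∉ X := by
  -- Without a separation, some join `C` in the graph without `w` and `u` links `v₁` to `v₂`.
  -- Together with an edge from `u` to each of them it is even at every vertex. Adding it to `F`
  -- modulo 2 keeps all parities and lifts the degree of `u` from 0 to 2, which is forbidden for a
  -- forest. It remains to restore acyclicity.
  by_contra! hc
  set S := (M.off w).filter fun e => ¬ M.Inc e u
  obtain ⟨C, hC, hCd⟩ := exists_join (M := M) (S := S)
    (τ := fun v => (if v = v₁ then 1 else 0) + if v = v₂ then 1 else 0) (fun X hX => by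
      have h1 := hc X hX
      have h2 := hc Xᶜ hX.compl
      rw [sum_add_distrib, sum_ite_eq', sum_ite_eq']
      simp only [mem_compl] at h2
      by_cases hv : v₁ ∈ X
      · simp [hv, h1 hv]
      · simp [hv, h2 hv])
  obtain ⟨a, ha⟩ := h₁
  obtain ⟨b, hb⟩ := h₂
  have hinc_off : ∀ {e v}, M.Link e u v → v ≠ w → e ∈ M.off w := fun {e v} hl hv => by
    rw [mem_off, hl.inc_iff]
    rintro (h | h)
    · exact hwu.ne h
    · exact hv h.symm
  have hab : a ≠ b := by
    rintro rfl
    rcases (ha.inc_iff v₂).1 hb.inc_right with h | h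
    · exact hb.ne h.symm
    · exact h₁₂ h.symm
  have haC : a ∉ C := fun h => (mem_filter.1 (hC h)).2 ha.inc_left
  have hbC : b ∉ C := fun h => (mem_filter.1 (hC h)).2 hb.inc_left
  obtain ⟨F, hF, hFodd, hac, hins⟩ := hM.exists_split w
  have hFu : M.dg F u = 0 := hM.dg_eq_zero_of_even hw (isSplit_self hF hac hFodd)
    (empty_subset _) hwu (by
      have h1 := dg_mod hF (hFodd u hwu.ne.symm)
      have h2 := Nat.even_iff.1 (hM.even_mult hw hwu.ne.symm)
      rw [Nat.odd_iff] at hu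
      rw [Nat.even_iff]
      omega)
  let cand : Finset (Finset B) := (M.off w).powerset.filter fun F' =>
    (∀ v, M.dg F' v % 2 = M.dg F v % 2) ∧ ∀ e, M.Inc e u → (e ∈ F' ↔ e = a ∨ e = b)
  have hcand : ∀ F', F' ∈ cand ↔ F' ⊆ M.off w ∧ (∀ v, M.dg F' v % 2 = M.dg F v % 2) ∧
      ∀ e, M.Inc e u → (e ∈ F' ↔ e = a ∨ e = b) := fun F' => by simp [cand]
  obtain ⟨H, hH, hmin⟩ := exists_min_image cand card ⟨symmDiff F (insert a (insert b C)), by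
    rw [hcand]
    refine ⟨fun e he => ?_, fun v => ?_, fun e he => ?_⟩
    · rw [mem_symmDiff, mem_insert, mem_insert] at he
      rcases he with he | ⟨rfl | rfl | he, -⟩
      · exact hF he.1
      · exact hinc_off ha h₁w
      · exact hinc_off hb h₂w
      · exact (mem_filter.1 (hC he)).1
    · have e1 := M.dg_symmDiff F (insert a (insert b C)) v
      have e2 := hCd v
      rw [dg_insert (by simp [hab, haC]), dg_insert hbC] at e1
      simp only [ha.inc_iff, hb.inc_iff] at e1
      have := ha.ne
      have := hb.ne
      split_ifs at e1 e2 <;> first | omega | (subst_vars; simp_all)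
    · rw [mem_symmDiff, mem_insert, mem_insert]
      have e1 : e ∉ F := fun h => dg_eq_zero.1 hFu e h he
      have e2 : e ∉ C := fun h => (mem_filter.1 (hC h)).2 he
      tauto⟩
  obtain ⟨hHo, hHd, hHu⟩ := (hcand H).1 hH
  have hHodd : ∀ x ≠ w, Odd (M.dg (M.off w \ H) x) := fun x hx => by
    have e1 := M.dg_sdiff hF x
    have e2 := M.dg_sdiff hHo x
    have e3 := hHd x
    have e4 := hFodd x hx
    rw [Nat.odd_iff] at e4 ⊢
    omega
  have hdgu : ∀ H', (∀ e, M.Inc e u → (e ∈ H' ↔ e ∈ H)) → M.dg H' u = 2 := fun H' h => by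
    have : M.dg H' u = M.dg {a, b} u := dg_congr fun e he => by
      rw [h e he, hHu e he]; simp
    rw [this, dg_insert (by simpa using hab), dg_singleton, if_pos hb.inc_left,
      if_pos ha.inc_left]
  have hdone : ∀ D H', M.IsSplit w D H' → D ⊆ M.off w →
      (∀ e, M.Inc e u → (e ∈ H' ↔ e ∈ H)) → False := fun D H' hs hD h => by
    have e1 := hdgu H' h
    have e2 := hM.dg_eq_zero_of_even hw hs hD hwu (by rw [e1]; decide)
    omega
  -- An even subset avoiding `a` also avoids `b` by parity at `u`, so removing it would give a
  -- smaller candidate.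
  have hmeet : ∀ C' ⊆ H, (∀ v, Even (M.dg C' v)) → C' ≠ ∅ → a ∈ C' := by
    intro C' hC' hev hne
    by_contra haC'
    have hbC' : b ∉ C' := fun hb' => by
      have e1 : M.dg C' u = 1 := by
        rw [← show M.dg {b} u = 1 by rw [dg_singleton, if_pos hb.inc_left]]
        refine dg_congr fun e he => ?_
        rw [mem_singleton]
        constructor
        · intro h
          rcases (hHu e he).1 (hC' h) with rfl | rfl
          · exact absurd h haC'
          · rfl
        · rintro rfl
          exact hb'
      have := hev u
      rw [e1] at this
      exact absurd this (by decide)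
    have e2 := hmin (H \ C') ((hcand _).2 ⟨sdiff_subset.trans hHo, fun v => by
      have e1 := M.dg_sdiff hC' v
      have e2 := hHd v
      have e3 := Nat.even_iff.1 (hev v)
      omega, fun e he => by
        rw [mem_sdiff, hHu e he, and_iff_left_iff_imp]
        rintro (rfl | rfl) <;> assumption⟩)
    rw [card_sdiff_of_subset hC'] at e2
    have e3 := card_le_card hC'
    have e4 := card_pos.2 (nonempty_iff_ne_empty.2 hne)
    omega
  by_cases hHac : M.Acyclic H
  · exact hdone ∅ H (isSplit_self hHo hHac hHodd) (empty_subset _) fun _ _ => Iff.rfl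
  · unfold Acyclic at hHac
    push Not at hHac
    obtain ⟨C', hC', hev, hne⟩ := hHac
    have haC' := hmeet C' hC' hev (nonempty_iff_ne_empty.1 hne)
    have e1 := M.dg_erase haC' v₁
    rw [if_pos ha.inc_right] at e1
    have e2 := Nat.even_iff.1 (hev v₁)
    -- Two distinct nonempty even subsets of `H` would both contain `a`, and their sum modulo 2
    -- would avoid it. So `C'` is the only cycle, and deleting its other edge `g` at `v₁` leaves a
    -- forest without touching `u`.
    obtain ⟨g, hg, hgv⟩ := M.dg_pos.1 (show 0 < M.dg (C'.erase a) v₁ by omega)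
    rw [mem_erase] at hg
    have hgu : ¬ M.Inc g u := fun h => by
      rcases (hHu g h).1 (hC' hg.2) with rfl | rfl
      · exact hg.1 rfl
      · rcases (hb.inc_iff v₁).1 hgv with h | h
        · exact ha.ne h.symm
        · exact h₁₂ h
    refine hdone {g} (H.erase g) ⟨by simp, by simp, (erase_subset _ _).trans hHo, ?_, ?_⟩
      (by simpa using hHo (hC' hg.2)) (fun e he => ?_)
    · intro C'' hC'' hev''
      by_contra hne''
      have h1 := hmeet C'' (hC''.trans (erase_subset _ _)) hev'' hne''
      have h2 : symmDiff C' C'' = ∅ := by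
        by_contra hne3
        have h3 := hmeet (symmDiff C' C'') (fun e he => by
          rw [mem_symmDiff] at he
          rcases he with he | he
          · exact hC' he.1
          · exact erase_subset _ _ (hC'' he.1)) (fun v => by
            have e1 := M.dg_symmDiff C' C'' v
            have e2 := Nat.even_iff.1 (hev v)
            have e3 := Nat.even_iff.1 (hev'' v)
            rw [Nat.even_iff]
            omega) hne3
        rw [mem_symmDiff] at h3
        tauto
      rw [symmDiff_eq_bot.1 h2] at hg
      exact notMem_erase _ _ (hC'' hg.2)
    · have : H.erase g ∪ {g} = H := by
        rw [union_comm, ← insert_eq, insert_erase (hC' hg.2)]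
      rwa [this]
    · rw [mem_erase, and_iff_right_iff_imp]
      rintro - rfl
      exact hgu he

/-- A vertex with exactly two neighbors, one of them joined to it by an even number of edges. -/
theorem isShannon_of_two_neighbors (hM : M.IsCritical) {w u v : V} (hw : Even (M.dg univ w))
    (hu : Odd (M.dg univ u)) (hv : Odd (M.dg univ v)) (hwu : M.Adj w u) (huv : M.Adj u v)
    (hvw : v ≠ w) (hN : ∀ x, M.Adj u x → x = w ∨ x = v) : M.IsShannon := by
  obtain ⟨F, hF, hFodd, hac, hins⟩ := hM.exists_split u
  have hmw := Nat.even_iff.1 (hM.even_mult hw hwu.ne.symm)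
  rw [mult_comm] at hmw
  have hm0 : ∀ x ≠ u, x ≠ w → x ≠ v → M.mult u x = 0 := fun x hxu hxw hxv => by
    by_contra h
    rcases hN x ((mult_pos hxu.symm).1 (Nat.pos_of_ne_zero h)) with h | h
    · exact hxw h
    · exact hxv h
  have hmv : M.mult u v % 2 = 1 := by
    have h1 := Nat.even_iff.1 (M.even_sum_mult u)
    rw [← sum_subset (s₁ := {w, v}) (by
        intro x
        simp only [mem_insert, mem_singleton, mem_erase, mem_univ, and_true]
        rintro (rfl | rfl)
        · exact hwu.ne
        · exact huv.ne.symm) (fun x hx hx' => by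
        simp only [mem_insert, mem_singleton, not_or] at hx'
        exact hm0 x (ne_of_mem_erase hx) hx'.1 hx'.2), sum_pair hvw.symm] at h1
    rw [Nat.odd_iff] at hu
    omega
  have hdw : M.dg F w % 2 = 1 := by
    have h1 := dg_mod hF (hFodd w hwu.ne)
    rw [Nat.even_iff] at hw
    omega
  have hdv : M.dg F v % 2 = 1 := by
    have h1 := dg_mod hF (hFodd v huv.ne.symm)
    rw [Nat.odd_iff] at hv
    omega
  -- Multiplicities from `u` are even to `w` and odd to `v`, so this is `nearlyColorable_of_root` at
  -- `u` in terms of forest degrees. The forests `F`, `F.erase f` and `insert e F` are tested in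
  -- turn; the first two show that `f` joins `w` and `v` and is the only edge of `F` at either.
  have key : ∀ (D H : Finset B) (r : V), M.IsSplit u D H → D ⊆ M.off u →
      (Odd (M.dg H w) ∧ w = r ∨ Even (M.dg H w) ∧ 2 ≤ M.dg H w) →
      (M.dg H v = 0 ∨ Odd (M.dg H v) ∧ (2 ≤ M.dg H v ∨ v = r)) → False := by
    intro D H r hs hD h1 h2
    refine hM.not_nearly (hs.nearlyColorable_of_root r ?_ fun x hx hpos => ?_)
    · rwa [star_eq hD, dg_star, mult_self]
    · rw [star_eq hD, dg_star] at hpos ⊢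
      rw [Nat.odd_iff, Nat.even_iff] at *
      rcases hN x ((mult_pos hx.symm).1 hpos) with rfl | rfl
      · rcases h1 with ⟨h1, h3⟩ | ⟨h1, h3⟩
        · exact Or.inl ⟨by omega, Or.inl h3⟩
        · exact Or.inr ⟨by omega, Or.inl h3⟩
      · rcases h2 with h2 | ⟨h2, h3⟩
        · exact Or.inl ⟨by omega, Or.inr h2⟩
        · exact Or.inr ⟨by omega, h3.imp_right fun h => ⟨h, by omega⟩⟩
  have hsF := isSplit_self hF hac hFodd
  have hFv : M.dg F v = 1 := by
    by_contra h
    exact key ∅ F w hsF (empty_subset _) (Or.inl ⟨Nat.odd_iff.2 hdw, rfl⟩)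
      (Or.inr ⟨Nat.odd_iff.2 hdv, Or.inl (by omega)⟩)
  obtain ⟨f, hf, hfv⟩ := M.dg_pos.1 (show 0 < M.dg F v by omega)
  have hse := isSplit_erase hF hac hFodd hf
  have hfo : {f} ⊆ M.off u := by simpa using hF hf
  have hev := M.dg_erase hf v
  rw [if_pos hfv] at hev
  have hew := M.dg_erase hf w
  have hfw : M.Inc f w := by
    by_contra h
    rw [if_neg h] at hew
    exact key {f} _ w hse hfo (Or.inl ⟨Nat.odd_iff.2 (by omega), rfl⟩) (Or.inl (by omega))
  rw [if_pos hfw] at hew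
  have hFw : M.dg F w = 1 := by
    by_contra h
    exact key {f} _ w hse hfo (Or.inr ⟨Nat.even_iff.2 (by omega), by omega⟩) (Or.inl (by omega))
  have hwv : M.Adj w v := ⟨f, link_of_inc hfw hfv hvw.symm⟩
  have hNw : ∀ t, M.Adj w t → t = u ∨ t = v := by
    -- A third neighbor of `w` would be joined to it by a parallel pair. Inserting one of these
    -- edges gives `w` forest degree 2, and `v`, of forest degree 1, can serve as root.
    intro t ht
    by_contra! hc
    obtain ⟨e, e', hne, he, he'⟩ := exists_pair_of_even ht (hM.even_mult hw ht.ne.symm)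
    have hnotF : ∀ g ∈ F, ¬ M.Link g w t := fun g hg hgl => by
      have : g = f :=
        card_le_one.1 hFw.le g (by simp [hg, hgl.inc_left]) f (by simp [hf, hfw])
      subst this
      rcases ((link_of_inc hfw hfv hvw.symm).inc_iff t).1 hgl.inc_right with h | h
      · exact ht.ne h.symm
      · exact hc.2 h
    have hoff : ∀ g, M.Link g w t → g ∈ M.off u := fun g hg => by
      rw [mem_off, hg.inc_iff]
      rintro (h | h)
      · exact hwu.ne h.symm
      · exact hc.1 h.symm
    have hs := isSplit_insert hF (hins e (hoff e he) w t he hnotF) hFodd hne he he' (hoff e he)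
      (fun h => hnotF e h he) (fun h => hnotF e' h he')
    have h1 := M.dg_insert (fun h => hnotF e h he) w
    have h2 := M.dg_insert (fun h => hnotF e h he) v
    rw [if_pos he.inc_left, hFw] at h1
    rw [if_neg (by rw [he.inc_iff]; rintro (h | h); exacts [hvw h, hc.2 h.symm]), hFv] at h2
    exact key {e'} _ v hs (by simpa using hoff e' he') (Or.inr (by rw [h1]; decide))
      (Or.inr (by rw [h2]; exact ⟨by decide, Or.inr rfl⟩))
  refine ⟨w, u, v, hwu.ne, hwv.ne, huv.ne, fun x => ?_, hwu, hwv, huv,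
    hM.even_mult hw hwu.ne.symm, hM.even_mult hw hwv.ne.symm⟩
  have hcl : M.Closed (M.off v) {w, u} := closed_of_link fun e he x y hl hx => by
    have hyv : y ≠ v := by
      rintro rfl
      exact mem_off.1 he hl.inc_right
    simp only [mem_insert, mem_singleton] at hx ⊢
    rcases hx with rfl | rfl
    · exact Or.inr ((hNw y ⟨e, hl⟩).resolve_right hyv)
    · exact Or.inl ((hN y ⟨e, hl⟩).resolve_right hyv)
  rcases hM.eq_empty_or_of_closed hv (by simp [hvw, huv.ne.symm]) hcl with h | h
  · simp at h
  · have := Finset.ext_iff.1 h x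
    simp only [mem_insert, mem_singleton, mem_erase, mem_univ, and_true] at this
    tauto

/-- Fix `w` of even degree and choose a neighbor `u` and a smallest nonempty closed set `X` of the
graph without `w` and `u`. Since `u` is no cut vertex, `X` contains a neighbor `z` of `w`. Two
further neighbors of `z` would be separated by deleting `w` and `z`, and the side missing `u` would
cut `X` down. So `z` has just one neighbor besides `w`. -/
theorem isShannon (hM : M.IsCritical) (hV : Odd (Fintype.card V)) : M.IsShannon := by
  classical
  by_contra hns
  have hodd : ∀ w u, Even (M.dg univ w) → M.Adj w u → Odd (M.dg univ u) := fun w u hw hwu =>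
    Nat.not_even_iff_odd.1 fun hu => hns (hM.isShannon_of_even hw hwu hu)
  obtain ⟨w, hw⟩ : ∃ w, Even (M.dg univ w) := by
    by_contra! hc
    simp only [Nat.not_even_iff_odd, Nat.odd_iff] at hc
    have h1 := Nat.even_iff.1 (even_sum_dg (M := M) (S := univ) (X := univ) (F := univ)
      (by simp [Closed]) Subset.rfl)
    have h2 := sum_mod_two (univ : Finset V) (f := fun v => M.dg univ v) (g := fun _ => 1)
      fun v _ => hc v
    rw [sum_const, smul_eq_mul, mul_one, card_univ] at h2
    rw [Nat.odd_iff] at hV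
    omega
  obtain ⟨u₀, hu₀⟩ : ∃ u, M.Adj w u := by
    by_contra! hc
    have h1 : ({w} : Finset V) = univ :=
      (hM.conn {w} (closed_of_link fun e _ x y hl hx => by
        rw [mem_singleton] at hx
        subst hx
        exact absurd ⟨e, hl⟩ (hc y))).resolve_left (by simp)
    refine hM.not_nearly ⟨∅, fun _ => 0, by simp, fun j v => Or.inl ?_⟩
    refine dg_eq_zero.2 fun e _ hi => ?_
    obtain ⟨y, hl⟩ := hi.exists_link
    have hv : v = w := by simpa using Finset.ext_iff.1 h1 v
    exact hc y (hv ▸ ⟨e, hl⟩)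
  have hnext : ∀ u, M.Adj w u → ∃ v, M.Adj u v ∧ v ≠ w := by
    intro u hu
    have h1 := hodd w u hw hu
    have h2 := hM.even_mult hw hu.ne.symm
    have h3 := M.dg_off_add_mult w u
    rw [Nat.odd_iff] at h1
    rw [Nat.even_iff] at h2
    obtain ⟨e, he, hi⟩ := M.dg_pos.1 (show 0 < M.dg (M.off w) u by omega)
    obtain ⟨v, hl⟩ := hi.exists_link
    refine ⟨v, ⟨e, hl⟩, ?_⟩
    rintro rfl
    exact mem_off.1 he hl.inc_right
  have hnextodd : ∀ u v, M.Adj w u → M.Adj u v → v ≠ w → Odd (M.dg univ v) := by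
    intro u v hu huv hvw
    rw [← Nat.not_even_iff_odd]
    intro hv
    obtain ⟨e, e', hne, he, he'⟩ := exists_pair_of_even huv.symm (hM.even_mult hv huv.ne)
    have := hodd w v hw (hM.adj_of_pair hw hu hvw hne he.symm he'.symm)
    exact Nat.not_even_iff_odd.2 this hv
  let S : V → Finset B := fun u => (M.off w).filter fun e => ¬ M.Inc e u
  have hS : ∀ {u e}, e ∈ S u ↔ ¬ M.Inc e w ∧ ¬ M.Inc e u := fun {u e} => by
    simp [S, mem_off]
  let cand : Finset (V × Finset V) := univ.filter fun p => M.Adj w p.1 ∧ w ∉ p.2 ∧ p.1 ∉ p.2 ∧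
    p.2.Nonempty ∧ M.Closed (S p.1) p.2
  have hcand : ∀ u X, (u, X) ∈ cand ↔ M.Adj w u ∧ w ∉ X ∧ u ∉ X ∧ X.Nonempty ∧
    M.Closed (S u) X := fun u X => by simp [cand]
  have hdiff : ∀ u X, M.Closed (S u) X → M.Closed (S u) (X \ {w, u}) := by
    intro u X hX e he
    have h1 := hX e he
    have h2 := hS.1 he
    simp only [Inc, not_or] at h2
    simp only [mem_sdiff, mem_insert, mem_singleton]
    tauto
  obtain ⟨⟨u, X⟩, huX, hmin⟩ := exists_min_image cand (fun p => p.2.card)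
    ⟨(u₀, univ \ {w, u₀}), (hcand _ _).2 ⟨hu₀, by simp, by simp, by
      obtain ⟨v, hv, hvw⟩ := hnext u₀ hu₀
      exact ⟨v, by simp [hvw, hv.ne.symm]⟩, hdiff u₀ univ (by simp [Closed])⟩⟩
  obtain ⟨hwu, hwX, huX, hne, hX⟩ := (hcand _ _).1 huX
  obtain ⟨z, hzX, hwz⟩ : ∃ z ∈ X, M.Adj w z := by
    by_contra! hc
    rcases hM.eq_empty_or_of_closed (hodd w u hw hwu) huX (closed_of_link fun e he x y hl hx => by
      refine (hX.mem_iff (hS.2 ⟨?_, mem_off.1 he⟩) hl).1 hx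
      rw [hl.inc_iff]
      rintro (rfl | rfl)
      · exact hwX hx
      · exact hc x hx ⟨e, hl.symm⟩) with h | h
    · exact hne.ne_empty h
    · exact hwX (h ▸ mem_erase.2 ⟨hwu.ne, mem_univ _⟩)
  obtain ⟨v, hzv, hvw⟩ := hnext z hwz
  refine hns (hM.isShannon_of_two_neighbors hw (hodd w z hw hwz) (hnextodd z v hwz hzv hvw) hwz
    hzv hvw fun x hzx => ?_)
  by_contra! hx
  obtain ⟨Y, hY, hxY, hvY⟩ :=
    hM.exists_separation hw hwz (hodd w z hw hwz) hzx hzv hx.1 hvw hx.2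
  -- The set `X ∩ Y` is closed once `w` and `z` are deleted: an edge leaving `X` would have to end
  -- in `u`, which `Y` avoids. It contains `t` but not `z`, contradicting the choice of `X`.
  have key : ∀ Y, M.Closed (S z) Y → u ∉ Y → (∃ t ∈ Y, M.Adj z t ∧ t ≠ w) → z ∉ Y → False := by
    rintro Y hY huY ⟨t, htY, hzt, htw⟩ hzY
    have htX : t ∈ X := by
      obtain ⟨e, hl⟩ := hzt
      refine (hX.mem_iff (hS.2 ⟨?_, ?_⟩) hl).1 hzX
      · rw [hl.inc_iff]
        rintro (h | h)
        · exact hwz.ne h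
        · exact htw h.symm
      · rw [hl.inc_iff]
        rintro (rfl | rfl)
        · exact huX hzX
        · exact huY htY
    have h1 := hmin (z, X ∩ Y) ((hcand _ _).2 ⟨hwz, fun h => hwX (mem_inter.1 h).1,
      fun h => hzY (mem_inter.1 h).2, ⟨t, mem_inter.2 ⟨htX, htY⟩⟩,
      closed_of_link fun e he x y hl hx => by
        rw [mem_inter] at hx ⊢
        have hy := (hY.mem_iff he hl).1 hx.2
        refine ⟨(hX.mem_iff (hS.2 ⟨(hS.1 he).1, ?_⟩) hl).1 hx.1, hy⟩
        rw [hl.inc_iff]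
        rintro (rfl | rfl)
        · exact huX hx.1
        · exact huY hy⟩)
    change X.card ≤ (X ∩ Y).card at h1
    have h2 : (X ∩ Y).card < X.card := card_lt_card
      ⟨inter_subset_left, fun h => hzY (mem_inter.1 (h hzX)).2⟩
    omega
  by_cases huY : u ∈ Y
  · exact key _ (hdiff z _ hY.compl) (by simp [huY]) ⟨v, by simp [hvY, hvw, hzv.ne.symm], hzv, hvw⟩
      (by simp)
  · exact key _ (hdiff z Y hY) (by simp [huY]) ⟨x, by simp [hxY, hx.1, hzx.ne.symm], hzx, hx.1⟩
      (by simp)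

end IsCritical

/-- A connected multigraph that is not a Shannon triangle becomes odd 3-edge-colorable after the
deletion of at most one edge. -/
theorem nearlyColorable (hconn : ∀ X, M.Closed univ X → X = ∅ ∨ X = univ) (hM : ¬ M.IsShannon) :
    M.NearlyColorable := by
  by_contra hn
  have hV : Odd (Fintype.card V) :=
    Nat.not_even_iff_odd.1 fun h => hn (nearlyColorable_of_even_card hconn h)
  refine hM (IsCritical.isShannon ⟨hn, hconn, fun w X hwX hX => ?_⟩ hV)
  rw [← Nat.not_odd_iff_even]
  exact fun h => hn (nearlyColorable_of_cut hconn hV hwX hX h)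

end Structure

end Multigraph

namespace OddEdge

open Finset

/-! ### Passage between `Graph` and `Multigraph`, and deletion of a single edge. -/

section Transfer

variable {α β : Type*} {G : Graph α β}

theorem colorClass_subset {k : ℕ} (φ : G.edgeSet → Fin k) (j : Fin k) :
    colorClass φ j ⊆ G.edgeSet := fun _ h => h.1

theorem formsOddGraph_singleton [G.Loopless] (e : β) : FormsOddGraph G {e} := by
  rintro v ⟨f, rfl, hf⟩
  have : {e ∈ ({f} : Set β) | G.Inc e v} = {f} := by
    ext e
    simp only [Set.mem_ofPred_eq, Set.mem_singleton_iff, and_iff_left_iff_imp]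
    rintro rfl
    exact hf
  rw [this, Set.ncard_singleton]
  exact odd_one

theorem oddEdgeColorable_of_oddChromaticIndex_le {k : ℕ} (h : oddChromaticIndex G ≤ k) :
    ∃ m ≤ k, OddEdgeColorable G m := by
  by_contra! hc
  have : ((k + 1 : ℕ) : ℕ∞) ≤ oddChromaticIndex G := by
    refine le_iInf₂ fun m hm => ?_
    have : k < m := by
      by_contra hmk
      exact hc m (not_lt.1 hmk) hm
    exact_mod_cast this
  have h2 := this.trans h
  norm_cast at h2
  omega

theorem OddEdgeColorable.oddChromaticIndex_le {k : ℕ} (h : OddEdgeColorable G k) :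
    oddChromaticIndex G ≤ k := iInf₂_le k h

theorem formsOddGraph_deleteEdges {e : β} {F : Set β} (he : e ∉ F) :
    FormsOddGraph (G.deleteEdges {e}) F ↔ FormsOddGraph G F := by
  have h : ∀ f ∈ F, ∀ v, (G.deleteEdges {e}).Inc f v ↔ G.Inc f v := fun f hf v => by
    rw [Graph.deleteEdges_inc, and_iff_left_iff_imp]
    rintro - rfl
    exact he hf
  unfold FormsOddGraph
  refine forall_congr' fun v => ?_
  have h1 : (∃ f ∈ F, (G.deleteEdges {e}).Inc f v) ↔ ∃ f ∈ F, G.Inc f v :=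
    exists_congr fun f => and_congr_right fun hf => h f hf v
  have h2 : {f ∈ F | (G.deleteEdges {e}).Inc f v} = {f ∈ F | G.Inc f v} := by
    ext f
    exact and_congr_right fun hf => h f hf v
  rw [h1, h2]

/-- Deleting the only edge of its color from an odd `(k + 1)`-edge-coloring. -/
theorem oddEdgeColorable_deleteEdges {k : ℕ} {φ : G.edgeSet → Fin (k + 1)} {j : Fin (k + 1)}
    {e : β} (hφ : IsOddEdgeColoring G φ) (hj : colorClass φ j = {e}) :
    OddEdgeColorable (G.deleteEdges {e}) k := by
  have hmem : ∀ f ∈ (G.deleteEdges {e}).edgeSet, ∃ hf : f ∈ G.edgeSet, φ ⟨f, hf⟩ ≠ j := by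
    intro f hf
    have hf' : f ∈ G.edgeSet ∧ f ∉ ({e} : Set β) := by simpa using hf
    refine ⟨hf'.1, fun h => hf'.2 ?_⟩
    rw [← hj]
    exact ⟨hf'.1, h⟩
  choose hfG hfj using fun f : (G.deleteEdges {e}).edgeSet => hmem f f.2
  choose ψ hψ using fun f => Fin.exists_succAbove_eq (hfj f)
  refine ⟨ψ, fun i => ?_⟩
  have h1 : colorClass ψ i = colorClass φ (j.succAbove i) := by
    ext f
    constructor
    · rintro ⟨hf, hi⟩
      exact ⟨hfG ⟨f, hf⟩, by rw [← hψ ⟨f, hf⟩, hi]⟩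
    · rintro ⟨hf, hi⟩
      have hfe : f ≠ e := by
        rintro rfl
        have : f ∈ colorClass φ j := hj ▸ rfl
        obtain ⟨_, h2⟩ := this
        exact Fin.succAbove_ne j i (hi.symm.trans h2)
      have hf' : f ∈ (G.deleteEdges {e}).edgeSet := by simpa using ⟨hf, hfe⟩
      refine ⟨hf', Fin.succAbove_right_injective (p := j) ?_⟩
      rw [hψ ⟨f, hf'⟩]
      exact hi
  rw [h1]
  refine (formsOddGraph_deleteEdges fun h => ?_).2 (hφ _)
  obtain ⟨hf, hi⟩ := h
  have : e ∈ colorClass φ j := hj ▸ rfl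
  obtain ⟨_, h2⟩ := this
  exact Fin.succAbove_ne j i (hi.symm.trans h2)

/-- Giving a new color to a deleted edge. -/
theorem exists_oddEdgeColoring_of_deleteEdges [G.Loopless] {k : ℕ} {e : β} (he : e ∈ G.edgeSet)
    (h : OddEdgeColorable (G.deleteEdges {e}) k) :
    ∃ φ : G.edgeSet → Fin (k + 1), IsOddEdgeColoring G φ ∧ colorClass φ (Fin.last k) = {e} := by
  classical
  obtain ⟨ψ, hψ⟩ := h
  have hmem : ∀ f ∈ G.edgeSet, f ≠ e → f ∈ (G.deleteEdges {e}).edgeSet := fun f hf hfe => by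
    simpa using ⟨hf, hfe⟩
  let φ : G.edgeSet → Fin (k + 1) := fun f =>
    if h : f.1 = e then Fin.last k else (ψ ⟨f, hmem f f.2 h⟩).castSucc
  have hlast : colorClass φ (Fin.last k) = {e} := by
    ext f
    rw [Set.mem_singleton_iff]
    constructor
    · rintro ⟨hf, h⟩
      by_contra hfe
      simp [φ, hfe, Fin.castSucc_ne_last] at h
    · rintro rfl
      exact ⟨he, by simp [φ]⟩
  refine ⟨φ, fun j => ?_, hlast⟩
  induction j using Fin.lastCases with
  | last =>
    rw [hlast]
    exact formsOddGraph_singleton e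
  | cast i =>
    have hi : colorClass φ i.castSucc = colorClass ψ i := by
      ext f
      constructor
      · rintro ⟨hf, h⟩
        by_cases hfe : f = e
        · simp [φ, hfe, (Fin.castSucc_ne_last i).symm] at h
        · simp only [φ, dif_neg hfe] at h
          exact ⟨hmem f hf hfe, Fin.castSucc_injective _ h⟩
      · rintro ⟨hf, h⟩
        have hf' : f ∈ G.edgeSet ∧ f ≠ e := by simpa using hf
        exact ⟨hf'.1, by simp only [φ, dif_neg hf'.2, h]⟩
    rw [hi]
    refine (formsOddGraph_deleteEdges fun h => ?_).1 (hψ i)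
    obtain ⟨he, _⟩ := h
    simp at he

/-- The multigraph on the vertices and edges of a loopless graph. -/
theorem exists_multigraph (G : Graph α β) [G.Loopless] :
    ∃ M : Multigraph G.vertexSet G.edgeSet, ∀ e x y, M.Link e x y ↔ G.IsLink e.1 x.1 y.1 := by
  choose s t hst using fun e : G.edgeSet => Graph.exists_isLink_of_mem_edgeSet e.2
  refine ⟨⟨fun e => ⟨s e, (hst e).left_mem⟩, fun e => ⟨t e, (hst e).right_mem⟩, fun e h => ?_⟩,
    fun e x y => ?_⟩
  · have h1 : s e = t e := congrArg Subtype.val h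
    exact Graph.Loopless.not_isLoopAt e.1 (s e) (by have := hst e; rwa [← h1] at this)
  · rw [(hst e).isLink_iff]
    simp only [Multigraph.Link, Subtype.ext_iff]

theorem inc_iff {M : Multigraph G.vertexSet G.edgeSet}
    (hM : ∀ e x y, M.Link e x y ↔ G.IsLink e.1 x.1 y.1) (e : G.edgeSet) (x : G.vertexSet) :
    M.Inc e x ↔ G.Inc e.1 x.1 := by
  constructor
  · intro h
    obtain ⟨y, hl⟩ := h.exists_link
    exact ((hM _ _ _).1 hl).inc_left
  · rintro ⟨y, hl⟩
    exact ((hM e x ⟨y, hl.right_mem⟩).2 hl).inc_left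

theorem formsOddGraph_image [DecidableEq G.vertexSet] {M : Multigraph G.vertexSet G.edgeSet}
    (hM : ∀ e x y, M.Link e x y ↔ G.IsLink e.1 x.1 y.1) {F : Finset G.edgeSet}
    (hF : M.OddSet F) : FormsOddGraph G (Subtype.val '' (F : Set G.edgeSet)) := by
  rintro v ⟨_, ⟨e, he, rfl⟩, hev⟩
  have hv := hev.vertex_mem
  have h1 : {f ∈ Subtype.val '' (F : Set G.edgeSet) | G.Inc f v} =
      Subtype.val '' ((F.filter fun f => M.Inc f ⟨v, hv⟩ : Finset G.edgeSet) : Set G.edgeSet) := by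
    ext f
    simp only [coe_filter, inc_iff hM]
    constructor
    · rintro ⟨⟨f, hf, rfl⟩, hi⟩
      exact ⟨f, ⟨hf, hi⟩, rfl⟩
    · rintro ⟨f, ⟨hf, hi⟩, rfl⟩
      exact ⟨⟨f, hf, rfl⟩, hi⟩
  rw [h1, Set.ncard_image_of_injective _ Subtype.val_injective, Set.ncard_coe_finset]
  exact (hF ⟨v, hv⟩).resolve_left
    (Multigraph.dg_pos.2 ⟨e, he, (inc_iff hM _ _).2 hev⟩).ne'

theorem closed_eq_empty_or_univ [Fintype G.vertexSet] [Fintype G.edgeSet]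
    {M : Multigraph G.vertexSet G.edgeSet}
    (hM : ∀ e x y, M.Link e x y ↔ G.IsLink e.1 x.1 y.1) (hconn : G.toSimpleGraph.Connected)
    (X : Finset G.vertexSet) (hX : M.Closed univ X) : X = ∅ ∨ X = univ := by
  rcases X.eq_empty_or_nonempty with h | ⟨x, hx⟩
  · exact Or.inl h
  · refine Or.inr (eq_univ_of_forall fun y => ?_)
    obtain ⟨p⟩ := hconn.preconnected x y
    induction p with
    | nil => exact hx
    | cons h _ ih =>
      refine ih ?_
      obtain ⟨-, e, hl⟩ := h
      exact (hX.mem_iff (mem_univ (⟨e, hl.edge_mem⟩ : G.edgeSet)) ((hM _ _ _).2 hl)).1 hx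

theorem ncard_linkSet [DecidableEq G.vertexSet] [Fintype G.edgeSet]
    {M : Multigraph G.vertexSet G.edgeSet}
    (hM : ∀ e x y, M.Link e x y ↔ G.IsLink e.1 x.1 y.1) {x y : G.vertexSet} (hxy : x ≠ y) :
    (linkSet G x.1 y.1).ncard = M.mult x y := by
  have h1 : linkSet G x.1 y.1 = Subtype.val ''
      (((univ.filter fun e => M.Inc e x).filter fun e => M.Inc e y : Finset G.edgeSet) :
        Set G.edgeSet) := by
    ext f
    constructor
    · intro hl
      have hl' := (hM ⟨f, Graph.IsLink.edge_mem hl⟩ x y).2 hl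
      exact ⟨⟨f, Graph.IsLink.edge_mem hl⟩, by simp [hl'.inc_left, hl'.inc_right], rfl⟩
    · rintro ⟨f, hf, rfl⟩
      simp only [coe_filter, mem_filter, mem_univ, true_and, Set.mem_ofPred_eq] at hf
      exact (hM _ _ _).1 (Multigraph.link_of_inc hf.1 hf.2 hxy)
  rw [h1, Set.ncard_image_of_injective _ Subtype.val_injective, Set.ncard_coe_finset]
  rfl

theorem isShannon222_or_isShannon221 [DecidableEq G.vertexSet] [Fintype G.edgeSet]
    {M : Multigraph G.vertexSet G.edgeSet}
    (hM : ∀ e x y, M.Link e x y ↔ G.IsLink e.1 x.1 y.1) (h : M.IsShannon) :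
    IsShannon222 G ∨ IsShannon221 G := by
  obtain ⟨x, y, z, hxy, hxz, hyz, hall, axy, axz, ayz, exy, exz⟩ := h
  have hadj : ∀ x y, M.Adj x y → G.Adj x.1 y.1 := fun x y ⟨e, hl⟩ => ⟨e.1, (hM _ _ _).1 hl⟩
  have hV : G.vertexSet = {x.1, y.1, z.1} := by
    ext v
    simp only [Set.mem_insert_iff, Set.mem_singleton_iff]
    constructor
    · intro hv
      rcases hall ⟨v, hv⟩ with h | h | h <;> simp [← h]
    · rintro (rfl | rfl | rfl)
      exacts [x.2, y.2, z.2]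
  rw [← ncard_linkSet hM hxy] at exy
  rw [← ncard_linkSet hM hxz] at exz
  rcases Nat.even_or_odd (linkSet G y.1 z.1).ncard with hp | hp
  · exact Or.inl ⟨x, y, z, Subtype.coe_ne_coe.2 hxy, Subtype.coe_ne_coe.2 hxz,
      Subtype.coe_ne_coe.2 hyz, hV, hadj _ _ axy, hadj _ _ axz, hadj _ _ ayz, exy, exz, hp⟩
  · exact Or.inr ⟨x, y, z, Subtype.coe_ne_coe.2 hxy, Subtype.coe_ne_coe.2 hxz,
      Subtype.coe_ne_coe.2 hyz, hV, hadj _ _ axy, hadj _ _ axz, hadj _ _ ayz, exy, exz, hp⟩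

theorem oddEdgeColorable_of_nearlyColorable [DecidableEq G.vertexSet] [DecidableEq G.edgeSet]
    [Fintype G.edgeSet] {M : Multigraph G.vertexSet G.edgeSet}
    (hM : ∀ e x y, M.Link e x y ↔ G.IsLink e.1 x.1 y.1) (h : M.NearlyColorable) :
    OddEdgeColorable G 3 ∨ ∃ e ∈ G.edgeSet, OddEdgeColorable (G.deleteEdges {e}) 3 := by
  obtain ⟨D, φ, hD, hφ⟩ := h
  rcases Nat.le_one_iff_eq_zero_or_eq_one.1 hD with h0 | h1
  · obtain rfl := card_eq_zero.1 h0
    refine Or.inl ⟨φ, fun j => ?_⟩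
    convert formsOddGraph_image hM (hφ j) using 1
    ext f
    simp [colorClass]
  · obtain ⟨e, rfl⟩ := card_eq_one.1 h1
    have hmem : ∀ f ∈ (G.deleteEdges {e.1}).edgeSet, f ∈ G.edgeSet ∧ f ≠ e.1 := fun f hf => by
      simpa using hf
    refine Or.inr ⟨e, e.2, fun f => φ ⟨f, (hmem f f.2).1⟩, fun j => ?_⟩
    rw [formsOddGraph_deleteEdges fun h => ?_]
    · convert formsOddGraph_image hM (hφ j) using 1
      ext f
      constructor
      · rintro ⟨hf, hj⟩
        refine ⟨⟨f, (hmem f hf).1⟩, ?_, rfl⟩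
        simp only [coe_filter, mem_univ, true_and, mem_singleton, Set.mem_ofPred_eq]
        exact ⟨fun h => (hmem f hf).2 (congrArg Subtype.val h), hj⟩
      · rintro ⟨f, hf, rfl⟩
        simp only [coe_filter, mem_univ, true_and, mem_singleton, Set.mem_ofPred_eq] at hf
        exact ⟨by simpa using fun h => hf.1 (Subtype.ext h), hf.2⟩
    · obtain ⟨he, _⟩ := h
      exact (hmem _ he).2 rfl

end Transfer

end OddEdge

theorem theorem1p3 {α β : Type*} (G : Graph α β) [G.Loopless]
    (hV : G.vertexSet.Finite) (hE : G.edgeSet.Finite)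
    (hconn : G.toSimpleGraph.Connected)
    (h222 : ¬ OddEdge.IsShannon222 G) (h221 : ¬ OddEdge.IsShannon221 G) :
    OddEdge.oddChromaticIndex G ≤ 3 ∨
      ((∃ (φ : G.edgeSet → Fin 4) (j : Fin 4) (e : β),
          OddEdge.IsOddEdgeColoring G φ ∧ OddEdge.colorClass φ j = {e}) ∧
        ∀ (φ : G.edgeSet → Fin 4) (j : Fin 4) (e : β),
          OddEdge.IsOddEdgeColoring G φ → OddEdge.colorClass φ j = {e} →
            OddEdge.oddChromaticIndex (G.deleteEdges {e}) = 3) := by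
  classical
  have := hV.fintype
  have := hE.fintype
  obtain ⟨M, hM⟩ := OddEdge.exists_multigraph G
  by_cases h3 : OddEdge.oddChromaticIndex G ≤ 3
  · exact Or.inl h3
  right
  have hn : M.NearlyColorable :=
    Multigraph.nearlyColorable (OddEdge.closed_eq_empty_or_univ hM hconn) fun h =>
      (OddEdge.isShannon222_or_isShannon221 hM h).elim h222 h221
  refine ⟨?_, fun φ j e hφ hj => ?_⟩
  · obtain ⟨e, he, h⟩ := (OddEdge.oddEdgeColorable_of_nearlyColorable hM hn).resolve_left
      fun h => h3 h.oddChromaticIndex_le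
    obtain ⟨φ, hφ, hlast⟩ := OddEdge.exists_oddEdgeColoring_of_deleteEdges he h
    exact ⟨φ, Fin.last 3, e, hφ, hlast⟩
  -- For the lower bound, a coloring of the graph without `e` with at most two colors extends by a
  -- new color on `e` to at most three colors, contradicting `h3`.
  · refine le_antisymm (OddEdge.oddEdgeColorable_deleteEdges hφ hj).oddChromaticIndex_le ?_
    by_contra hlt
    have hle : OddEdge.oddChromaticIndex (G.deleteEdges {e}) ≤ (2 : ℕ) :=
      Order.lt_add_one_iff_of_not_isMax (by simp) |>.1 (not_le.1 hlt)
    obtain ⟨m, hm, hcol⟩ := OddEdge.oddEdgeColorable_of_oddChromaticIndex_le hle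
    have he : e ∈ G.edgeSet := OddEdge.colorClass_subset φ j (hj ▸ Set.mem_singleton e)
    obtain ⟨ψ, hψ, -⟩ := OddEdge.exists_oddEdgeColoring_of_deleteEdges he hcol
    refine h3 ((OddEdge.OddEdgeColorable.oddChromaticIndex_le ⟨ψ, hψ⟩).trans ?_)
    exact_mod_cast Nat.succ_le_succ hm
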